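/- Let $f,g$ be Möbius transformations, i.e. elements of $PSL(2,\mathbb C)$. If $A,B\in SL(2,\mathbb C)$ represent $f,g$, put $\beta(f)=\operatorname{tr}^2(A)-4$ and $\gamma(f,g)=\operatorname{tr}(ABA^{-1}B^{-1})-2$; these do not depend on the choice of representatives. A good word on the letters $a,b$ is a word $w(a,b)=b^{s_1}a^{r_1}b^{s_2}a^{r_2}\cdots b^{s_{m-1}}a^{r_{m-1}}b^{s_m}$ with $m\ge 1$, $s_1=\pm1$, $s_j=(-1)^{j+1}s_1$ and $r_j\in\mathbb Z$ (zero exponents $r_j$ are allowed). For a good word $w$, its trace polynomial $p_w(z,x)$ is the unique polynomial with integer coefficients such that $\gamma(f,w(f,g))=p_w(\gamma(f,g),\beta(f))$ for all Möbius transformations $f,g$. **Theorem.** Let $f,g$ be Möbius transformations with $\beta=\beta(f)\ne-4$ and $\beta(g)=-4$ (so $g$ has order $2$), and let $\gamma=\gamma(f,g)$. Suppose that it is not the case that $\langle f,g\rangle$ is both discrete in $PSL(2,\mathbb C)$ and free on $f$ and $g$, where free on $f$ and $g$ means that the natural homomorphism from the free product $\langle f\rangle*\langle g\rangle$ onto $\langle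 f,g\rangle$ is an isomorphism. Then for every open set $U\subseteq\mathbb C$ containing $\gamma$ there is a good word $w$ which has a trace polynomial $p_w$ such that the polynomial $q_w(z)=p_w(z,\beta)\in\mathbb C[z]$ is not identically zero and has a root in $U$. -/

import Mathlib

namespace TraceRoots

/-- The group of Möbius transformations, `PSL(2, ℂ)`, with its quotient topology. -/
abbrev Moebius : Type := Matrix.ProjectiveSpecialLinearGroup (Fin 2) ℂ

/-- `β(A) = tr²(A) - 4` for a matrix `A`. -/
noncomputable def betaSL (A : Matrix.SpecialLinearGroup (Fin 2) ℂ) : ℂ :=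
  A.1.trace ^ 2 - 4

/-- `γ(A, B) = tr(A B A⁻¹ B⁻¹) - 2` for matrices `A`, `B`. -/
noncomputable def gammaSL (A B : Matrix.SpecialLinearGroup (Fin 2) ℂ) : ℂ :=
  (A * B * A⁻¹ * B⁻¹).1.trace - 2

theorem betaSL_congr {A A' : Matrix.SpecialLinearGroup (Fin 2) ℂ}
    (h : A⁻¹ * A' ∈ Subgroup.center (Matrix.SpecialLinearGroup (Fin 2) ℂ)) :
    betaSL A = betaSL A' := by
  obtain ⟨r, hr, hc⟩ := Matrix.SpecialLinearGroup.mem_center_iff.mp h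
  have hr2 : r ^ 2 = 1 := by simpa using hr
  have hA : A' = A * (A⁻¹ * A') := by group
  have ht : A'.1.trace = r * A.1.trace := by
    rw [hA]
    change (A.1 * (A⁻¹ * A').1).trace = _
    rw [← hc, Matrix.scalar_apply, ← Matrix.smul_one_eq_diagonal]
    simp
  unfold betaSL
  rw [ht, mul_pow, hr2, one_mul]

theorem gammaSL_congr {A A' B B' : Matrix.SpecialLinearGroup (Fin 2) ℂ}
    (hA : A⁻¹ * A' ∈ Subgroup.center (Matrix.SpecialLinearGroup (Fin 2) ℂ))
    (hB : B⁻¹ * B' ∈ Subgroup.center (Matrix.SpecialLinearGroup (Fin 2) ℂ)) :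
    gammaSL A B = gammaSL A' B' := by
  have key : ∀ P Q c d : Matrix.SpecialLinearGroup (Fin 2) ℂ,
      c ∈ Subgroup.center (Matrix.SpecialLinearGroup (Fin 2) ℂ) →
      d ∈ Subgroup.center (Matrix.SpecialLinearGroup (Fin 2) ℂ) →
      (P * c) * (Q * d) * (P * c)⁻¹ * (Q * d)⁻¹ = P * Q * P⁻¹ * Q⁻¹ := by
    intro P Q c d hc hd
    have hc' := Subgroup.mem_center_iff.mp hc
    have hd' := Subgroup.mem_center_iff.mp hd
    calc (P * c) * (Q * d) * (P * c)⁻¹ * (Q * d)⁻¹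
        = P * (c * Q) * d * c⁻¹ * P⁻¹ * d⁻¹ * Q⁻¹ := by group
      _ = P * (Q * c) * d * c⁻¹ * P⁻¹ * d⁻¹ * Q⁻¹ := by rw [hc' Q]
      _ = P * Q * (c * d) * c⁻¹ * P⁻¹ * d⁻¹ * Q⁻¹ := by group
      _ = P * Q * (d * c) * c⁻¹ * P⁻¹ * d⁻¹ * Q⁻¹ := by rw [hd' c]
      _ = P * Q * (d * P⁻¹) * d⁻¹ * Q⁻¹ := by group
      _ = P * Q * (P⁻¹ * d) * d⁻¹ * Q⁻¹ := by rw [hd' P⁻¹]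
      _ = P * Q * P⁻¹ * Q⁻¹ := by group
  have h := key A B _ _ hA hB
  rw [mul_inv_cancel_left, mul_inv_cancel_left] at h
  unfold gammaSL
  rw [h]

/-- The parameter `β(f) = tr²(f) - 4` of a Möbius transformation. -/
noncomputable def beta (f : Moebius) : ℂ :=
  Quotient.liftOn f betaSL fun _ _ h => betaSL_congr (QuotientGroup.leftRel_apply.mp h)

/-- The parameter `γ(f, g) = tr [f, g] - 2` of a pair of Möbius transformations. -/
noncomputable def gamma (f g : Moebius) : ℂ :=
  Quotient.liftOn₂ f g gammaSL fun _ _ _ _ h k =>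
    gammaSL_congr (QuotientGroup.leftRel_apply.mp h) (QuotientGroup.leftRel_apply.mp k)

theorem beta_mk (A : Matrix.SpecialLinearGroup (Fin 2) ℂ) :
    beta (QuotientGroup.mk A) = A.1.trace ^ 2 - 4 := rfl

theorem gamma_mk (A B : Matrix.SpecialLinearGroup (Fin 2) ℂ) :
    gamma (QuotientGroup.mk A) (QuotientGroup.mk B) = (A * B * A⁻¹ * B⁻¹).1.trace - 2 := rfl

/-- The alternating product
`b ^ s * a ^ r₁ * b ^ (-s) * a ^ r₂ * b ^ s * ⋯ * a ^ r_k * b ^ (± s)`, for the list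
`[r₁, …, r_k]` of exponents. -/
def altProd {G : Type*} [Group G] (a b : G) : ℤ → List ℤ → G
  | s, [] => b ^ s
  | s, r :: rs => b ^ s * a ^ r * altProd a b (-s) rs

/-- A good word on the letters `a`, `b` (the generators `0`, `1` of the free group): a word
`b ^ s₁ a ^ r₁ b ^ s₂ a ^ r₂ ⋯ a ^ r_{m-1} b ^ s_m` with `s₁ = ± 1`,
`s_j = (-1) ^ (j+1) s₁` and arbitrary integers `r_j`. -/
def IsGoodWord (w : FreeGroup (Fin 2)) : Prop :=
  ∃ (s : ℤ) (rs : List ℤ), (s = 1 ∨ s = -1) ∧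
    w = altProd (FreeGroup.of 0) (FreeGroup.of 1) s rs

/-- The element `w(f, g)` obtained by substituting `f` for `a` and `g` for `b`. -/
def evalWord {G : Type*} [Group G] (w : FreeGroup (Fin 2)) (f g : G) : G :=
  FreeGroup.lift ![f, g] w

/-- For `p ∈ ℤ[x][z]` and a complex number `β`, the one variable polynomial `p(β, z) ∈ ℂ[z]`. -/
noncomputable def specialize (p : Polynomial (Polynomial ℤ)) (β : ℂ) : Polynomial ℂ :=
  p.map (Polynomial.eval₂RingHom (Int.castRingHom ℂ) β)

/-- `p ∈ ℤ[x][z]` is the trace polynomial of the word `w`: for all Möbius transformations `f`, `g`,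
`γ(f, w(f, g))` is the value of `p` at `x = β(f)`, `z = γ(f, g)`. As `(β(f), γ(f, g))` takes all
values in `ℂ²`, there is at most one such `p`. -/
def IsTracePolynomial (w : FreeGroup (Fin 2)) (p : Polynomial (Polynomial ℤ)) : Prop :=
  ∀ f g : Moebius, gamma f (evalWord w f g) = (specialize p (beta f)).eval (gamma f g)

/-- The group `⟨f, g⟩` generated by `f` and `g` is a discrete subgroup of `PSL(2, ℂ)`. -/
def GeneratesDiscrete (f g : Moebius) : Prop :=
  DiscreteTopology (Subgroup.closure ({f, g} : Set Moebius))

/-- The group `⟨f, g⟩` is free on `f` and `g`: it is the free product `⟨f⟩ * ⟨g⟩`, that is, the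
natural map from the free product onto `⟨f, g⟩` is injective. -/
def IsFreeOn (f g : Moebius) : Prop :=
  Function.Injective
    (Monoid.Coprod.lift (Subgroup.zpowers f).subtype (Subgroup.zpowers g).subtype)

end TraceRoots

/-!
A pair `(f, g)` with `γ ≠ 0` is conjugate to the pair represented by `A_c = [[u, c], [0, u⁻¹]]` and
`J = [[0, -1], [1, 0]]`, for which `β = (u - u⁻¹)²` and `γ = (u - u⁻¹)² + c²`. With `β` fixed these
groups form a polynomial family in `c`, and a polynomial `q_w` has a root near `γ` as soon as
`γ(A_z, w(A_z, J))` vanishes for some `z` near `c` while the word `w` is reduced.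

Suppose that no reduced good word does this. Then `⟨f, g⟩` is free on `f` and `g`, since a relation
would give a reduced good word with `γ(f, w(f, g)) = 0`. No element of the family with nonconstant
trace has finite order at a point near `c`: one of its powers would be central there, which is again
a reduced word with a root. Hence its trace omits `[-2, 2]` on a disc around `c`, and the Schwarz
lemma bounds the derivative of the trace by a multiple of `|tr² - 4|`.

This estimate makes the group at `c` discrete. Read over the dual numbers, at `c + ε`, it says that
the tangent vectors at `1` of the family are determined by their values at `ε = 0`. If the group at
`c` accumulates at `1`, these tangent vectors are nonzero, and their complex span is a form of
`𝔰𝔩₂(ℂ[ε])` over `ℂ` which the family preserves by conjugation. Then the squared traces of the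
family are constant to first order in `ε`, whereas `tr (A_{c + ε} J) = c + ε`.
-/

namespace TraceRoots

open Filter Polynomial Topology
open scoped MatrixGroups

/-! ### Good words and free products -/

section Words

variable {G H : Type*} [Group G] [Group H]

theorem map_altProd (φ : G →* H) (a b : G) (s : ℤ) (rs : List ℤ) :
    φ (altProd a b s rs) = altProd (φ a) (φ b) s rs := by
  induction rs generalizing s with
  | nil => simp [altProd]
  | cons r rs ih => simp [altProd, ih]

theorem altProd_conj (a b k : G) (s : ℤ) (rs : List ℤ) :
    altProd (k * a * k⁻¹) (k * b * k⁻¹) s rs = k * altProd a b s rs * k⁻¹ :=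
  (map_altProd (MulAut.conj k).toMonoidHom a b s rs).symm

theorem evalWord_altProd (f g : G) (s : ℤ) (rs : List ℤ) :
    evalWord (altProd (FreeGroup.of 0) (FreeGroup.of 1) s rs) f g = altProd f g s rs := by
  simp [evalWord, map_altProd]

theorem altProd_neg {a b : G} (hb : b * b = 1) (s : ℤ) (rs : List ℤ) :
    altProd a b (-s) rs = altProd a b s rs := by
  have hzpow (s : ℤ) : b ^ (-s) = b ^ s := by
    rw [zpow_neg, ← inv_zpow, inv_eq_of_mul_eq_one_left hb]
  induction rs generalizing s with
  | nil => exact hzpow s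
  | cons r rs ih => rw [altProd, altProd, hzpow, ih]

/-- `x` is a power of `a`, or an alternating product of `a` and `b` in which no inner power of `a`
is trivial, multiplied on both sides by powers of `a`. For an involution `b` these are the normal
forms of the elements of `⟨a, b⟩`. -/
def HasReducedForm (a b x : G) : Prop :=
  (∃ r : ℤ, x = a ^ r) ∨
    ∃ (r r' : ℤ) (rs : List ℤ), (∀ i ∈ rs, a ^ i ≠ 1) ∧ x = a ^ r * altProd a b 1 rs * a ^ r'

theorem HasReducedForm.zpow_mul {a b x : G} (h : HasReducedForm a b x) (k : ℤ) :
    HasReducedForm a b (a ^ k * x) := by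
  rcases h with ⟨r, rfl⟩ | ⟨r, r', rs, hrs, rfl⟩
  · exact .inl ⟨k + r, (zpow_add a k r).symm⟩
  · exact .inr ⟨k + r, r', rs, hrs, by simp only [zpow_add, mul_assoc]⟩

theorem HasReducedForm.involution_mul {a b x : G} (hb : b * b = 1) (h : HasReducedForm a b x) :
    HasReducedForm a b (b * x) := by
  rcases h with ⟨r, rfl⟩ | ⟨r, r', rs, hrs, rfl⟩
  · exact .inr ⟨0, r, [], by simp, by simp [altProd]⟩
  by_cases hr : a ^ r = 1
  · rw [hr, one_mul]
    cases rs with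
    | nil =>
      refine .inl ⟨r', ?_⟩
      rw [altProd, zpow_one, ← mul_assoc, hb, one_mul]
    | cons i rs =>
      refine .inr ⟨i, r', rs, fun j hj => hrs j (List.mem_cons_of_mem _ hj), ?_⟩
      rw [altProd, zpow_one, altProd_neg hb]
      simp only [← mul_assoc]
      rw [hb, one_mul]
  · refine .inr ⟨0, r', r :: rs, List.forall_mem_cons.mpr ⟨hr, hrs⟩, ?_⟩
    rw [altProd, zpow_one, altProd_neg hb, zpow_zero, one_mul]
    simp only [mul_assoc]

theorem hasReducedForm_of_mem_closure {a b x : G} (hb : b * b = 1)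
    (hx : x ∈ Subgroup.closure ({a, b} : Set G)) : HasReducedForm a b x := by
  induction hx using Subgroup.closure_induction_left with
  | one => exact .inl ⟨0, (zpow_zero a).symm⟩
  | mul_left g hg y hy ih =>
    rcases hg with rfl | rfl
    · simpa using ih.zpow_mul 1
    · exact ih.involution_mul hb
  | inv_mul_cancel g hg y hy ih =>
    rcases hg with rfl | rfl
    · simpa using ih.zpow_mul (-1)
    · rw [inv_eq_of_mul_eq_one_left hb]
      exact ih.involution_mul hb

theorem coprod_zpowers_mem_closure (f g : G)
    (x : Monoid.Coprod (Subgroup.zpowers f) (Subgroup.zpowers g)) :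
    x ∈ Subgroup.closure {Monoid.Coprod.inl ⟨f, Subgroup.mem_zpowers f⟩,
      Monoid.Coprod.inr ⟨g, Subgroup.mem_zpowers g⟩} := by
  induction x using Monoid.Coprod.induction_on with
  | inl y =>
    obtain ⟨_, r, rfl⟩ := y
    have hr : (⟨f ^ r, r, rfl⟩ : Subgroup.zpowers f) = ⟨f, Subgroup.mem_zpowers f⟩ ^ r := rfl
    rw [hr, map_zpow]
    exact zpow_mem (Subgroup.subset_closure (by simp)) r
  | inr y =>
    obtain ⟨_, r, rfl⟩ := y
    have hr : (⟨g ^ r, r, rfl⟩ : Subgroup.zpowers g) = ⟨g, Subgroup.mem_zpowers g⟩ ^ r := rfl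
    rw [hr, map_zpow]
    exact zpow_mem (Subgroup.subset_closure (by simp)) r
  | mul y z hy hz => exact mul_mem hy hz

theorem exists_relation_of_not_injective_lift {f g : G} (hg : g * g = 1)
    (h : ¬ Function.Injective
      (Monoid.Coprod.lift (Subgroup.zpowers f).subtype (Subgroup.zpowers g).subtype)) :
    ∃ (r r' : ℤ) (rs : List ℤ), (∀ i ∈ rs, f ^ i ≠ 1) ∧ f ^ r * altProd f g 1 rs * f ^ r' = 1 := by
  by_contra! hcon
  refine h ((injective_iff_map_eq_one _).mpr fun x hx => ?_)
  have hf_one (r : ℤ) (hr : f ^ r = 1) : (Monoid.Coprod.inl ⟨f, Subgroup.mem_zpowers f⟩ :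
      Monoid.Coprod (Subgroup.zpowers f) (Subgroup.zpowers g)) ^ r = 1 := by
    rw [← map_zpow, ← map_one Monoid.Coprod.inl]
    exact congrArg _ (Subtype.ext hr)
  have hg_one : (Monoid.Coprod.inr ⟨g, Subgroup.mem_zpowers g⟩ :
      Monoid.Coprod (Subgroup.zpowers f) (Subgroup.zpowers g)) *
        Monoid.Coprod.inr ⟨g, Subgroup.mem_zpowers g⟩ = 1 := by
    rw [← map_mul, ← map_one Monoid.Coprod.inr]
    exact congrArg _ (Subtype.ext hg)
  rcases hasReducedForm_of_mem_closure hg_one (coprod_zpowers_mem_closure f g x) with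
    ⟨r, rfl⟩ | ⟨r, r', rs, hrs, rfl⟩
  · exact hf_one r (by simpa using hx)
  · refine absurd ?_ (hcon r r' rs fun i hi h0 => hrs i hi (hf_one i h0))
    simpa [map_altProd] using hx

end Words

/-! ### Traces of commutators and trace polynomials -/

section CommTrace

variable {R S : Type*} [CommRing R] [CommRing S]

theorem coe_mul_SL2 (A B : SL(2, R)) : (A * B).1 = A.1 * B.1 := rfl

theorem coe_inv_SL2 (A : SL(2, R)) : (A⁻¹).1 = A.1.trace • 1 - A.1 := by
  rw [Matrix.SpecialLinearGroup.SL2_inv_expl]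
  ext i j
  fin_cases i <;> fin_cases j <;> simp [Matrix.trace_fin_two]

theorem mul_self_SL2 (A : SL(2, R)) : A.1 * A.1 = A.1.trace • A.1 - 1 := by
  have h : A.1 * (A⁻¹).1 = 1 := by rw [← coe_mul_SL2, mul_inv_cancel]; rfl
  rw [coe_inv_SL2, mul_sub, mul_smul_comm, mul_one] at h
  rw [← h, sub_sub_cancel]

theorem trace_inv_SL2 (A : SL(2, R)) : (A⁻¹).1.trace = A.1.trace := by
  rw [coe_inv_SL2, Matrix.trace_sub, Matrix.trace_smul, Matrix.trace_one, Fintype.card_fin,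
    smul_eq_mul]
  push_cast
  ring

theorem trace_mul_inv_SL2 (A B : SL(2, R)) :
    (A * B⁻¹).1.trace = A.1.trace * B.1.trace - (A * B).1.trace := by
  rw [coe_mul_SL2, coe_inv_SL2, mul_sub, mul_smul_comm, mul_one, Matrix.trace_sub,
    Matrix.trace_smul, smul_eq_mul, mul_comm, coe_mul_SL2]

theorem trace_conj_SL2 (A B : SL(2, R)) : (B * A * B⁻¹).1.trace = A.1.trace := by
  rw [coe_mul_SL2, Matrix.trace_mul_comm, ← coe_mul_SL2, inv_mul_cancel_left]

/-- The trace parameter `tr (A B A⁻¹ B⁻¹) - 2` over an arbitrary commutative ring; over `ℂ` it is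
`gammaSL`. -/
def commTrace (A B : SL(2, R)) : R :=
  (A * B * A⁻¹ * B⁻¹).1.trace - 2

theorem commTrace_eq (A B : SL(2, R)) :
    commTrace A B = A.1.trace ^ 2 - (A * (B * A * B⁻¹)).1.trace - 2 := by
  have h : A * B * A⁻¹ * B⁻¹ = A * (B * A * B⁻¹)⁻¹ := by group
  rw [commTrace, h, trace_mul_inv_SL2, trace_conj_SL2, sq]

theorem commTrace_conj (A B C : SL(2, R)) :
    commTrace (C * A * C⁻¹) (C * B * C⁻¹) = commTrace A B := by
  have h : C * A * C⁻¹ * (C * B * C⁻¹) * (C * A * C⁻¹)⁻¹ * (C * B * C⁻¹)⁻¹ =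
      C * (A * B * A⁻¹ * B⁻¹) * C⁻¹ := by group
  rw [commTrace, commTrace, h, trace_conj_SL2]

theorem commTrace_zpow_mul_mul_zpow (A B : SL(2, R)) (r r' : ℤ) :
    commTrace A (A ^ r * B * A ^ r') = commTrace A B := by
  have h : A * (A ^ r * B * A ^ r') * A⁻¹ * (A ^ r * B * A ^ r')⁻¹ =
      A ^ r * (A * B * A⁻¹ * B⁻¹) * (A ^ r)⁻¹ := by group
  rw [commTrace, commTrace, h, trace_conj_SL2]

theorem commTrace_map (φ : R →+* S) (A B : SL(2, R)) :
    commTrace (Matrix.SpecialLinearGroup.map φ A) (Matrix.SpecialLinearGroup.map φ B) =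
      φ (commTrace A B) := by
  rw [commTrace, commTrace, ← map_inv, ← map_inv, ← map_mul, ← map_mul, ← map_mul, map_sub,
    map_ofNat, Matrix.SpecialLinearGroup.map_apply_coe, RingHom.mapMatrix_apply,
    AddMonoidHom.map_trace]

end CommTrace

section Center

variable {R S : Type*} [CommRing R] [CommRing S]

theorem mem_center_of_coe_eq_smul_one {M : SL(2, R)} {k : R} (h : M.1 = k • 1) :
    M ∈ Subgroup.center SL(2, R) := by
  have hdet := M.2
  rw [h, Matrix.det_smul, Matrix.det_one, mul_one] at hdet
  refine Matrix.SpecialLinearGroup.mem_center_iff.mpr ⟨k, hdet, ?_⟩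
  rw [h, Matrix.scalar_apply, Matrix.smul_one_eq_diagonal]

theorem mul_self_mem_center_of_trace_eq_zero {A : SL(2, R)} (hA : A.1.trace = 0) :
    A * A ∈ Subgroup.center SL(2, R) :=
  mem_center_of_coe_eq_smul_one (k := -1) <| by
    rw [coe_mul_SL2, mul_self_SL2, hA, zero_smul, zero_sub, neg_smul, one_smul]

theorem map_mem_center_SL2 (φ : R →+* S) {W : SL(2, R)}
    (hW : W ∈ Subgroup.center SL(2, R)) :
    Matrix.SpecialLinearGroup.map φ W ∈ Subgroup.center SL(2, S) := by
  obtain ⟨k, hk, hkW⟩ := Matrix.SpecialLinearGroup.mem_center_iff.mp hW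
  refine Matrix.SpecialLinearGroup.mem_center_iff.mpr ⟨φ k, by rw [← map_pow, hk, map_one], ?_⟩
  rw [Matrix.SpecialLinearGroup.map_apply_coe, ← hkW, RingHom.mapMatrix_apply,
    Matrix.scalar_apply, Matrix.scalar_apply, Matrix.diagonal_map (map_zero φ)]

theorem trace_sq_eq_of_inv_mul_mem_center {A B : SL(2, R)}
    (h : A⁻¹ * B ∈ Subgroup.center SL(2, R)) : B.1.trace ^ 2 = A.1.trace ^ 2 := by
  obtain ⟨k, hk, hkAB⟩ := Matrix.SpecialLinearGroup.mem_center_iff.mp h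
  rw [Fintype.card_fin] at hk
  rw [← mul_inv_cancel_left A B, coe_mul_SL2 A, ← hkAB, Matrix.scalar_apply,
    ← Matrix.smul_one_eq_diagonal, mul_smul_comm, mul_one, Matrix.trace_smul, smul_eq_mul, mul_pow,
    hk, one_mul]

theorem center_le_of_mem_of_trace_eq_zero [IsDomain R] {N : Subgroup SL(2, R)}
    {B : SL(2, R)} (hBN : B ∈ N) (hB : B.1.trace = 0) : Subgroup.center SL(2, R) ≤ N := by
  intro W hW
  obtain ⟨k, hk, hkW⟩ := Matrix.SpecialLinearGroup.mem_center_iff.mp hW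
  rw [Matrix.scalar_apply, ← Matrix.smul_one_eq_diagonal] at hkW
  rw [Fintype.card_fin, sq_eq_one_iff] at hk
  rcases hk with rfl | rfl
  · have hW1 : W = 1 := Subtype.ext (by simpa using hkW.symm)
    exact hW1 ▸ one_mem N
  · have hWB : W = B * B := Subtype.ext (by
      rw [coe_mul_SL2, mul_self_SL2, hB, ← hkW, zero_smul, zero_sub, neg_smul, one_smul])
    exact hWB ▸ mul_mem hBN hBN

theorem commTrace_eq_zero_of_mem_center {A W : SL(2, R)} {r r' : ℤ}
    (h : A ^ r * W * A ^ r' ∈ Subgroup.center SL(2, R)) : commTrace A W = 0 := by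
  rw [← commTrace_zpow_mul_mul_zpow A W r r', commTrace, Subgroup.mem_center_iff.mp h A,
    mul_inv_cancel_right, mul_inv_cancel, Matrix.SpecialLinearGroup.coe_one, Matrix.trace_one]
  simp

end Center

section TraceRing

variable {R : Type*} [CommRing R] (S : Subring R)

/-- The `S`-module spanned by `t`, `A`, `C` and `t A C`, where `t = tr A`. Only even powers of `t`
appear in the relations between these matrices, so that `S` need not contain `t` itself. -/
def evenSpan (A C : SL(2, R)) : Submodule S (Matrix (Fin 2) (Fin 2) R) :=
  Submodule.span S {A.1.trace • 1, A.1, C.1, A.1.trace • (A.1 * C.1)}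

variable {S}

theorem evenSpan_smul_mem {A C : SL(2, R)} {s : R} (hs : s ∈ S) {M : Matrix (Fin 2) (Fin 2) R}
    (hM : M ∈ evenSpan S A C) : s • M ∈ evenSpan S A C :=
  (evenSpan S A C).smul_mem ⟨s, hs⟩ hM

theorem trace_smul_one_mem_evenSpan (A C : SL(2, R)) : A.1.trace • 1 ∈ evenSpan S A C :=
  Submodule.subset_span (by simp)

theorem left_mem_evenSpan (A C : SL(2, R)) : A.1 ∈ evenSpan S A C :=
  Submodule.subset_span (by simp)

theorem right_mem_evenSpan (A C : SL(2, R)) : C.1 ∈ evenSpan S A C :=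
  Submodule.subset_span (by simp)

theorem trace_smul_mul_mem_evenSpan (A C : SL(2, R)) :
    A.1.trace • (A.1 * C.1) ∈ evenSpan S A C :=
  Submodule.subset_span (by simp)

theorem mul_swap_SL2 {A C : SL(2, R)} (h : A.1.trace = C.1.trace) :
    C.1 * A.1 = A.1.trace • A.1 + A.1.trace • C.1 - (A.1.trace ^ 2 - (A * C).1.trace) • 1 -
      A.1 * C.1 := by
  rw [coe_mul_SL2]
  generalize A.1 = M at h
  generalize C.1 = N at h
  rw [Matrix.trace_fin_two, Matrix.trace_fin_two] at h
  have hN : N 1 1 = M 0 0 + M 1 1 - N 0 0 := by linear_combination -h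
  ext i j
  fin_cases i <;> fin_cases j <;>
    simp [Matrix.trace_fin_two, Matrix.mul_apply, Fin.sum_univ_two, hN] <;> ring

theorem conj_mem_evenSpan {A C A' C' V : SL(2, R)} (hone : A.1.trace = A'.1.trace)
    (hA : (V * A * V⁻¹).1 ∈ evenSpan S A' C') (hC : (V * C * V⁻¹).1 ∈ evenSpan S A' C')
    (hAC : A'.1.trace • (V * (A * C) * V⁻¹).1 ∈ evenSpan S A' C')
    {M : Matrix (Fin 2) (Fin 2) R} (hM : M ∈ evenSpan S A C) :
    V.1 * M * (V⁻¹).1 ∈ evenSpan S A' C' := by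
  induction hM using Submodule.span_induction with
  | mem M hM =>
    rcases hM with rfl | rfl | rfl | rfl
    · rw [mul_smul_comm, mul_one, smul_mul_assoc, ← coe_mul_SL2, mul_inv_cancel, hone]
      exact trace_smul_one_mem_evenSpan A' C'
    · exact hA
    · exact hC
    · rw [mul_smul_comm, smul_mul_assoc, hone]
      exact hAC
  | zero => simp
  | add M N _ _ hM hN => rw [mul_add, add_mul]; exact add_mem hM hN
  | smul s M _ hM => rw [mul_smul_comm, smul_mul_assoc]; exact Submodule.smul_mem _ s hM

section Relations

variable {A C : SL(2, R)} (h : A.1.trace = C.1.trace)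
include h

theorem conj_SL2_eq :
    (A * C * A⁻¹).1 =
      A.1.trace • 1 - (A * C).1.trace • A.1 + A.1.trace • (A.1 * C.1) - C.1 := by
  rw [coe_mul_SL2, coe_inv_SL2, mul_sub, mul_smul_comm, mul_one, coe_mul_SL2 A C, mul_assoc,
    mul_swap_SL2 h, coe_mul_SL2]
  simp only [mul_sub, mul_add, mul_smul_comm, ← mul_assoc, mul_self_SL2, mul_one, sub_mul, one_mul,
    smul_mul_assoc]
  module

theorem trace_smul_conj_mul_SL2_eq :
    A.1.trace • (A * (A * C) * A⁻¹).1 =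
      (A.1.trace ^ 2 - 1) • (A.1.trace • (A.1 * C.1)) - A.1.trace ^ 2 • C.1 +
        (A.1.trace ^ 2 - A.1.trace ^ 2 * (A * C).1.trace) • A.1 +
        (A * C).1.trace • (A.1.trace • 1) := by
  have hconj : A * (A * C) * A⁻¹ = A * (A * C * A⁻¹) := by group
  rw [hconj, coe_mul_SL2, conj_SL2_eq h]
  simp only [mul_sub, mul_add, mul_smul_comm, ← mul_assoc, mul_self_SL2, mul_one, sub_mul, one_mul,
    smul_mul_assoc]
  module

theorem inv_conj_SL2_eq :
    (A⁻¹ * C * A).1 =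
      (A.1.trace ^ 2 - 1) • C.1 - A.1.trace • (A.1 * C.1) +
        (A.1.trace ^ 2 - (A * C).1.trace) • A.1 +
        (1 - A.1.trace ^ 2 + (A * C).1.trace) • (A.1.trace • 1) := by
  rw [mul_assoc, coe_mul_SL2, coe_mul_SL2, coe_inv_SL2, sub_mul, smul_mul_assoc, one_mul,
    mul_swap_SL2 h]
  simp only [mul_sub, mul_add, mul_smul_comm, ← mul_assoc, mul_self_SL2, mul_one, sub_mul, one_mul,
    smul_mul_assoc]
  module

variable (ht : A.1.trace ^ 2 ∈ S) (hu : (A * C).1.trace ∈ S)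
include ht hu

theorem trace_smul_swap_mem_evenSpan : A.1.trace • (C * A).1 ∈ evenSpan S A C := by
  have heq : A.1.trace • (C * A).1 = A.1.trace ^ 2 • A.1 + A.1.trace ^ 2 • C.1 -
      (A.1.trace ^ 2 - (A * C).1.trace) • (A.1.trace • 1) - A.1.trace • (A.1 * C.1) := by
    rw [coe_mul_SL2, mul_swap_SL2 h]
    module
  rw [heq]
  exact sub_mem (sub_mem (add_mem (evenSpan_smul_mem ht (left_mem_evenSpan A C))
    (evenSpan_smul_mem ht (right_mem_evenSpan A C)))
    (evenSpan_smul_mem (S.sub_mem ht hu) (trace_smul_one_mem_evenSpan A C)))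
    (trace_smul_mul_mem_evenSpan A C)

theorem conj_self_mem_evenSpan {M : Matrix (Fin 2) (Fin 2) R} (hM : M ∈ evenSpan S A C) :
    A.1 * M * (A⁻¹).1 ∈ evenSpan S A C := by
  refine conj_mem_evenSpan (A := A) (V := A) rfl ?_ ?_ ?_ hM
  · rw [mul_inv_cancel_right]
    exact left_mem_evenSpan A C
  · rw [conj_SL2_eq h]
    exact sub_mem (add_mem (sub_mem (trace_smul_one_mem_evenSpan A C)
      (evenSpan_smul_mem hu (left_mem_evenSpan A C))) (trace_smul_mul_mem_evenSpan A C))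
      (right_mem_evenSpan A C)
  · rw [trace_smul_conj_mul_SL2_eq h]
    exact add_mem (add_mem (sub_mem
      (evenSpan_smul_mem (S.sub_mem ht S.one_mem) (trace_smul_mul_mem_evenSpan A C))
      (evenSpan_smul_mem ht (right_mem_evenSpan A C)))
      (evenSpan_smul_mem (S.sub_mem ht (S.mul_mem ht hu)) (left_mem_evenSpan A C)))
      (evenSpan_smul_mem hu (trace_smul_one_mem_evenSpan A C))

theorem inv_conj_self_mem_evenSpan {M : Matrix (Fin 2) (Fin 2) R} (hM : M ∈ evenSpan S A C) :
    (A⁻¹).1 * M * A.1 ∈ evenSpan S A C := by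
  suffices (A⁻¹).1 * M * (A⁻¹⁻¹).1 ∈ evenSpan S A C by rwa [inv_inv] at this
  refine conj_mem_evenSpan (A := A) (V := A⁻¹) rfl ?_ ?_ ?_ hM
  · rw [inv_inv, inv_mul_cancel, one_mul]
    exact left_mem_evenSpan A C
  · rw [inv_inv, inv_conj_SL2_eq h]
    exact add_mem (add_mem (sub_mem
      (evenSpan_smul_mem (S.sub_mem ht S.one_mem) (right_mem_evenSpan A C))
      (trace_smul_mul_mem_evenSpan A C))
      (evenSpan_smul_mem (S.sub_mem ht hu) (left_mem_evenSpan A C)))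
      (evenSpan_smul_mem (S.add_mem (S.sub_mem S.one_mem ht) hu) (trace_smul_one_mem_evenSpan A C))
  · rw [inv_inv, inv_mul_cancel_left]
    exact trace_smul_swap_mem_evenSpan h ht hu

theorem zpow_conj_mem_evenSpan (r : ℤ) {M : Matrix (Fin 2) (Fin 2) R}
    (hM : M ∈ evenSpan S A C) : (A ^ r).1 * M * (A ^ (-r)).1 ∈ evenSpan S A C := by
  induction r with
  | zero => simpa using hM
  | succ r ih =>
    have hpos : A ^ (r + 1 : ℤ) = A * A ^ (r : ℤ) := by group
    have hneg : A ^ (-(r + 1) : ℤ) = A ^ (-r : ℤ) * A⁻¹ := by group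
    rw [hpos, hneg, coe_mul_SL2, coe_mul_SL2, ← mul_assoc, mul_assoc A.1, mul_assoc A.1]
    exact conj_self_mem_evenSpan h ht hu ih
  | pred r ih =>
    have hneg : A ^ (-r - 1 : ℤ) = A⁻¹ * A ^ (-r : ℤ) := by group
    have hpos : A ^ (-(-r - 1) : ℤ) = A ^ (-(-r) : ℤ) * A := by group
    rw [hpos, hneg, coe_mul_SL2, coe_mul_SL2, ← mul_assoc, mul_assoc (A⁻¹).1, mul_assoc (A⁻¹).1]
    exact inv_conj_self_mem_evenSpan h ht hu ih

theorem trace_mul_mem_of_mem_evenSpan {M : Matrix (Fin 2) (Fin 2) R}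
    (hM : M ∈ evenSpan S A C) : (A.1 * M).trace ∈ S := by
  induction hM using Submodule.span_induction with
  | mem M hM =>
    rcases hM with rfl | rfl | rfl | rfl
    · rw [mul_smul_comm, mul_one, Matrix.trace_smul, smul_eq_mul, ← sq]
      exact ht
    · have heq : (A.1 * A.1).trace = A.1.trace ^ 2 - 2 := by
        rw [mul_self_SL2, Matrix.trace_sub, Matrix.trace_smul, Matrix.trace_one, smul_eq_mul, sq,
          Fintype.card_fin, Nat.cast_ofNat]
      rw [heq]
      exact sub_mem ht (ofNat_mem S 2)
    · exact hu
    · have heq : (A.1 * (A.1.trace • (A.1 * C.1))).trace =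
          A.1.trace ^ 2 * (A * C).1.trace - A.1.trace ^ 2 := by
        rw [mul_smul_comm, ← mul_assoc, mul_self_SL2, sub_mul, smul_mul_assoc, one_mul,
          Matrix.trace_smul, Matrix.trace_sub, Matrix.trace_smul, ← h, smul_eq_mul, smul_eq_mul,
          coe_mul_SL2]
        ring
      rw [heq]
      exact sub_mem (mul_mem ht hu) ht
  | zero => simp
  | add M N _ _ hM hN => rw [mul_add, Matrix.trace_add]; exact add_mem hM hN
  | smul s M _ hM =>
    rw [mul_smul_comm, Matrix.trace_smul]
    exact mul_mem s.2 hM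

end Relations

theorem trace_mul_zpow_conj_mem {A B : SL(2, R)} (hu : (A * (B * A * B⁻¹)).1.trace ∈ S) {s : ℤ}
    (hs : s = 1 ∨ s = -1) : (A * (B ^ s * A * B ^ (-s))).1.trace ∈ S := by
  rcases hs with rfl | rfl
  · simpa using hu
  · have heq : A * (B ^ (-1 : ℤ) * A * B ^ (- -1 : ℤ)) = B⁻¹ * (B * A * B⁻¹ * A) * B⁻¹⁻¹ := by group
    rwa [heq, trace_conj_SL2, coe_mul_SL2, Matrix.trace_mul_comm, ← coe_mul_SL2]

theorem conj_altProd_mem_evenSpan {A B : SL(2, R)} (ht : A.1.trace ^ 2 ∈ S)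
    (hu : (A * (B * A * B⁻¹)).1.trace ∈ S) {s : ℤ} (hs : s = 1 ∨ s = -1) (rs : List ℤ) :
    (altProd A B s rs * A * (altProd A B s rs)⁻¹).1 ∈ evenSpan S A (B ^ s * A * B ^ (-s)) := by
  have hC (s : ℤ) : A.1.trace = (B ^ s * A * B ^ (-s)).1.trace := by
    rw [zpow_neg, trace_conj_SL2]
  induction rs generalizing s with
  | nil =>
    rw [altProd, ← zpow_neg]
    exact right_mem_evenSpan _ _
  | cons r rs ih =>
    have hs' : -s = 1 ∨ -s = -1 := by omega
    have hM := zpow_conj_mem_evenSpan (hC (-s)) ht (trace_mul_zpow_conj_mem hu hs') r (ih hs')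
    have heq : altProd A B s (r :: rs) * A * (altProd A B s (r :: rs))⁻¹ =
        B ^ s * (A ^ r * (altProd A B (-s) rs * A * (altProd A B (-s) rs)⁻¹) * A ^ (-r)) *
          (B ^ s)⁻¹ := by
      rw [altProd]; group
    rw [heq]
    refine conj_mem_evenSpan (A := A) (V := B ^ s) rfl ?_ ?_ ?_ hM
    · rw [← zpow_neg]
      exact right_mem_evenSpan _ _
    · convert left_mem_evenSpan _ _
      group
    · convert trace_smul_swap_mem_evenSpan (hC s) ht (trace_mul_zpow_conj_mem hu hs) using 3
      group

theorem commTrace_altProd_mem {A B : SL(2, R)} (hA : A.1.trace ^ 2 - 4 ∈ S)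
    (hAB : commTrace A B ∈ S) {s : ℤ} (hs : s = 1 ∨ s = -1) (rs : List ℤ) :
    commTrace A (altProd A B s rs) ∈ S := by
  have ht : A.1.trace ^ 2 ∈ S := by simpa using add_mem hA (ofNat_mem S 4)
  have hiff (B : SL(2, R)) : commTrace A B ∈ S ↔ (A * (B * A * B⁻¹)).1.trace ∈ S := by
    have heq : commTrace A B = A.1.trace ^ 2 - 2 + -(A * (B * A * B⁻¹)).1.trace := by
      rw [commTrace_eq]; ring
    rw [heq, add_mem_cancel_left (sub_mem ht (ofNat_mem S 2)), neg_mem_iff]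
  rw [hiff] at hAB ⊢
  have hC : A.1.trace = (B ^ s * A * B ^ (-s)).1.trace := by rw [zpow_neg, trace_conj_SL2]
  exact trace_mul_mem_of_mem_evenSpan hC ht (trace_mul_zpow_conj_mem hAB hs)
    (conj_altProd_mem_evenSpan ht hAB hs rs)

end TraceRing

section TracePolynomial

theorem mk_altProd (A B : SL(2, ℂ)) (s : ℤ) (rs : List ℤ) :
    (QuotientGroup.mk (altProd A B s rs) : Moebius) =
      altProd (QuotientGroup.mk A) (QuotientGroup.mk B) s rs :=
  map_altProd (QuotientGroup.mk' _) A B s rs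

/-- The matrix whose entries are the coordinate functions of the matrices `P i`. Thus an identity
over the commutative ring `ι → R` is an identity that holds for all `P i` simultaneously. -/
def piSL {ι R : Type*} [CommRing R] (P : ι → SL(2, R)) : SL(2, ι → R) :=
  ⟨Matrix.of fun i j k => (P k).1 i j, by
    funext k
    rw [Matrix.det_fin_two]
    exact (Matrix.det_fin_two _).symm.trans (P k).2⟩

theorem map_eval_piSL {ι R : Type*} [CommRing R] (P : ι → SL(2, R)) (k : ι) :
    Matrix.SpecialLinearGroup.map (Pi.evalRingHom (fun _ => R) k) (piSL P) = P k := by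
  rfl

theorem exists_isTracePolynomial_altProd {s : ℤ} (hs : s = 1 ∨ s = -1) (rs : List ℤ) :
    ∃ p, IsTracePolynomial (altProd (FreeGroup.of 0) (FreeGroup.of 1) s rs) p := by
  let A : SL(2, SL(2, ℂ) × SL(2, ℂ) → ℂ) := piSL Prod.fst
  let B : SL(2, SL(2, ℂ) × SL(2, ℂ) → ℂ) := piSL Prod.snd
  let ev : ℤ[X][X] →+* (SL(2, ℂ) × SL(2, ℂ) → ℂ) :=
    eval₂RingHom
      (eval₂RingHom (Int.castRingHom _) (A.1.trace ^ 2 - 4)) (commTrace A B)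
  have hA : A.1.trace ^ 2 - 4 ∈ ev.range := ⟨C X, by simp [ev]⟩
  have hAB : commTrace A B ∈ ev.range := ⟨X, by simp [ev]⟩
  obtain ⟨p, hp⟩ := commTrace_altProd_mem hA hAB hs rs
  refine ⟨p, fun f g => ?_⟩
  obtain ⟨M, hM⟩ := QuotientGroup.mk_surjective f
  obtain ⟨N, hN⟩ := QuotientGroup.mk_surjective g
  let π : (SL(2, ℂ) × SL(2, ℂ) → ℂ) →+* ℂ := Pi.evalRingHom (fun _ => ℂ) (M, N)
  have hπA : Matrix.SpecialLinearGroup.map π A = M := map_eval_piSL _ _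
  have hπB : Matrix.SpecialLinearGroup.map π B = N := map_eval_piSL _ _
  have hβ : π (A.1.trace ^ 2 - 4) = beta f := by
    rw [← hM, beta_mk, ← hπA, map_sub, map_pow, map_ofNat,
      Matrix.SpecialLinearGroup.map_apply_coe, RingHom.mapMatrix_apply, AddMonoidHom.map_trace]
  have hγ : π (commTrace A B) = gamma f g := by
    rw [← commTrace_map, hπA, hπB, ← hM, ← hN]
    rfl
  have hcomp : π.comp ev = eval₂RingHom
      (eval₂RingHom (Int.castRingHom ℂ) (beta f)) (gamma f g) := by
    rw [← hβ, ← hγ]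
    ext <;> simp [ev]
  calc gamma f (evalWord (altProd (FreeGroup.of 0) (FreeGroup.of 1) s rs) f g)
      = commTrace M (altProd M N s rs) := by
        rw [evalWord_altProd, ← hM, ← hN, ← mk_altProd]
        rfl
    _ = (π.comp ev) p := by
        rw [RingHom.comp_apply, hp, ← commTrace_map, map_altProd, hπA, hπB]
    _ = (specialize p (beta f)).eval (gamma f g) := by
        rw [hcomp, specialize, eval_map]
        rfl

end TracePolynomial

/-! ### The standard pair and reduced words -/

section StandardPair

variable {R S : Type*} [CommRing R] [CommRing S]

/-- The matrix `[[u, c], [0, u⁻¹]]`, with `turnSL` the first member of the standard pair to which a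
pair of matrices with `tr B = 0` is conjugated. -/
def upperSL (u : Rˣ) (c : R) : SL(2, R) :=
  ⟨!![(u : R), c; 0, ((u⁻¹ : Rˣ) : R)], by simp [Matrix.det_fin_two]⟩

/-- The matrix `[[0, -1], [1, 0]]`, a square root of `-1`. -/
def turnSL (R : Type*) [CommRing R] : SL(2, R) :=
  ⟨!![0, -1; 1, 0], by simp [Matrix.det_fin_two]⟩

theorem coe_upperSL (u : Rˣ) (c : R) :
    (upperSL u c).1 = !![(u : R), c; 0, ((u⁻¹ : Rˣ) : R)] := rfl

theorem coe_turnSL : (turnSL R).1 = !![0, -1; 1, 0] := rfl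

theorem map_upperSL (φ : R →+* S) (u : Rˣ) (c : R) :
    Matrix.SpecialLinearGroup.map φ (upperSL u c) = upperSL (Units.map φ u) (φ c) := by
  ext i j
  fin_cases i <;> fin_cases j <;> simp [coe_upperSL, ← map_inv]

theorem map_turnSL (φ : R →+* S) :
    Matrix.SpecialLinearGroup.map φ (turnSL R) = turnSL S := by
  ext i j
  fin_cases i <;> fin_cases j <;> simp [coe_turnSL]

theorem upperSL_mul (u v : Rˣ) (c d : R) :
    upperSL u c * upperSL v d = upperSL (u * v) (u * d + c * (v⁻¹ : Rˣ)) := by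
  ext i j
  fin_cases i <;> fin_cases j <;> simp [coe_upperSL, mul_comm]

theorem upperSL_inv (u : Rˣ) (c : R) : (upperSL u c)⁻¹ = upperSL u⁻¹ (-c) := by
  rw [inv_eq_iff_mul_eq_one, upperSL_mul, mul_inv_cancel]
  ext i j
  fin_cases i <;> fin_cases j <;> simp [coe_upperSL, mul_comm]

theorem coe_turnSL_inv : ((turnSL R)⁻¹).1 = -(turnSL R).1 := by
  simp [coe_turnSL]

theorem commTrace_upperSL (u : Rˣ) (c : R) (W : SL(2, R)) :
    commTrace (upperSL u c) W =
      W.1 1 0 * (c ^ 2 * W.1 1 0 + c * (u - (u⁻¹ : Rˣ)) * (W.1 0 0 - W.1 1 1) -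
        (u - (u⁻¹ : Rˣ)) ^ 2 * W.1 0 1) := by
  have hu := u.mul_inv
  have hW := W.2
  rw [Matrix.det_fin_two] at hW
  rw [commTrace_eq, coe_mul_SL2, coe_mul_SL2, coe_mul_SL2,
    Matrix.SpecialLinearGroup.coe_inv, Matrix.adjugate_fin_two, coe_upperSL]
  simp only [Matrix.trace_fin_two, Matrix.mul_apply, Fin.sum_univ_two]
  simp
  linear_combination (2 * (W.1 0 0 * W.1 1 1 - W.1 0 1 * W.1 1 0)) * hu +
    (2 - (u + (u⁻¹ : Rˣ)) ^ 2) * hW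

theorem commTrace_upperSL_turnSL (u : Rˣ) (c : R) :
    commTrace (upperSL u c) (turnSL R) = (u - (u⁻¹ : Rˣ)) ^ 2 + c ^ 2 := by
  rw [commTrace_upperSL]
  simp [coe_turnSL, add_comm]

theorem trace_upperSL (u : Rˣ) (c : R) : (upperSL u c).1.trace = u + (u⁻¹ : Rˣ) := by
  simp [coe_upperSL, Matrix.trace_fin_two]

theorem trace_turnSL : (turnSL R).1.trace = 0 := by
  simp [coe_turnSL, Matrix.trace_fin_two]

theorem eq_upperSL_of_apply {M : SL(2, R)} {u : Rˣ} (h00 : M.1 0 0 = u) (h10 : M.1 1 0 = 0) :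
    M = upperSL u (M.1 0 1) := by
  have hdet := M.2
  rw [Matrix.det_fin_two, h00, h10, mul_zero, sub_zero, Units.mul_eq_one_iff_inv_eq] at hdet
  ext i j
  fin_cases i <;> fin_cases j <;> simp [coe_upperSL, h00, h10, hdet]

theorem exists_add_inv_eq (t : ℂ) : ∃ u : ℂˣ, (u : ℂ) + (u⁻¹ : ℂˣ) = t := by
  obtain ⟨s, hs⟩ := IsAlgClosed.exists_pow_nat_eq (t ^ 2 - 4) two_pos
  have h : (t + s) / 2 * ((t - s) / 2) = 1 := by linear_combination -hs / 4
  exact ⟨⟨(t + s) / 2, (t - s) / 2, h, by rw [mul_comm, h]⟩, by simp; ring⟩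

end StandardPair

section CommonEigenvector

variable {K : Type*} [Field K]

theorem trace_eq_two_of_mulVec_eq {M : SL(2, K)} {v : Fin 2 → K} (hv : v ≠ 0)
    (h : M.1.mulVec v = v) : M.1.trace = 2 := by
  have hdet : (M.1 - 1).det = 0 := Matrix.exists_mulVec_eq_zero_iff.mp
    ⟨v, hv, by rw [Matrix.sub_mulVec, h, Matrix.one_mulVec, sub_self]⟩
  have hM := M.2
  rw [Matrix.det_fin_two] at hdet hM
  simp only [Matrix.sub_apply, Matrix.one_apply_eq, Matrix.one_apply_ne, ne_eq, Fin.reduceEq,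
    not_false_eq_true, sub_zero] at hdet
  rw [Matrix.trace_fin_two]
  linear_combination hM - hdet

theorem commTrace_eq_zero_of_mulVec_eq_smul {A B : SL(2, K)} {v : Fin 2 → K} {l k : K}
    (hv : v ≠ 0) (hl : l ≠ 0) (hk : k ≠ 0) (hA : A.1.mulVec v = l • v)
    (hB : B.1.mulVec v = k • v) : commTrace A B = 0 := by
  have hAB : (A * B).1.mulVec v = (k * l) • v := by
    rw [coe_mul_SL2, ← Matrix.mulVec_mulVec, hB, Matrix.mulVec_smul, hA, smul_smul]
  have hBA : (B * A).1.mulVec v = (k * l) • v := by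
    rw [coe_mul_SL2, ← Matrix.mulVec_mulVec, hA, Matrix.mulVec_smul, hB, smul_smul, mul_comm]
  have hcomm : A * B * A⁻¹ * B⁻¹ * (B * A) = A * B := by group
  have hfix : (A * B * A⁻¹ * B⁻¹).1.mulVec ((k * l) • v) = (k * l) • v := by
    rw [← hBA, Matrix.mulVec_mulVec, ← coe_mul_SL2, hcomm, hAB, hBA]
  rw [commTrace, trace_eq_two_of_mulVec_eq (smul_ne_zero (mul_ne_zero hk hl) hv) hfix, sub_self]

theorem exists_mulVec_eq_smul {A : SL(2, K)} {u : Kˣ} (hA : A.1.trace = u + (u⁻¹ : Kˣ)) :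
    ∃ v ≠ 0, A.1.mulVec v = (u : K) • v := by
  have hdet : (A.1 - (u : K) • 1).det = 0 := by
    have hA' := A.2
    rw [Matrix.trace_fin_two] at hA
    rw [Matrix.det_fin_two] at hA' ⊢
    simp
    linear_combination hA' - u * hA - u.mul_inv
  obtain ⟨v, hv, h⟩ := Matrix.exists_mulVec_eq_zero_iff.mpr hdet
  refine ⟨v, hv, ?_⟩
  rwa [Matrix.sub_mulVec, Matrix.smul_mulVec, Matrix.one_mulVec, sub_eq_zero] at h

theorem det_ne_zero_of_commTrace_ne_zero {A B : SL(2, K)} (hB : B.1.trace = 0)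
    (hAB : commTrace A B ≠ 0) {u : Kˣ} {v : Fin 2 → K} (hv : v ≠ 0)
    (hA : A.1.mulVec v = (u : K) • v) :
    (Matrix.of ![v, B.1.mulVec v]).det ≠ 0 := by
  intro hdet
  obtain ⟨x, hx, hx0⟩ := Matrix.exists_vecMul_eq_zero_iff.mpr hdet
  have hrel : x 0 • v + x 1 • B.1.mulVec v = 0 := by
    rw [← hx0]
    ext i
    simp only [Matrix.vecMul, dotProduct, Fin.sum_univ_two, Pi.add_apply, Pi.smul_apply,
      smul_eq_mul, Matrix.of_apply, Matrix.cons_val_zero, Matrix.cons_val_one]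
  have hx1 : x 1 ≠ 0 := by
    intro h1
    rw [h1, zero_smul, add_zero, smul_eq_zero_iff_left hv] at hrel
    exact hx (by ext i; fin_cases i <;> assumption)
  have hBv : B.1.mulVec v = (-((x 1)⁻¹ * x 0)) • v := by
    rw [neg_smul, mul_smul, eq_neg_of_add_eq_zero_left hrel, smul_neg, neg_neg, inv_smul_smul₀ hx1]
  refine hAB (commTrace_eq_zero_of_mulVec_eq_smul hv u.ne_zero ?_ hA hBv)
  intro h0
  have hBB : B.1.mulVec (B.1.mulVec v) = -v := by
    rw [Matrix.mulVec_mulVec, mul_self_SL2, hB, zero_smul, zero_sub, Matrix.neg_mulVec,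
      Matrix.one_mulVec]
  rw [hBv, h0, zero_smul, Matrix.mulVec_zero, eq_comm, neg_eq_zero] at hBB
  exact hv hBB

theorem exists_eq_conj_upperSL {A T : SL(2, K)} {u : Kˣ}
    (h : ∀ i, (A * T).1 i 0 = u * T.1 i 0) : ∃ c, A = T * upperSL u c * T⁻¹ := by
  have happly (i : Fin 2) : (T⁻¹ * A * T).1 i 0 = u * (T⁻¹ * T).1 i 0 := by
    rw [mul_assoc, coe_mul_SL2, coe_mul_SL2 T⁻¹ T]
    simp only [Matrix.mul_apply, Fin.sum_univ_two, h]
    ring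
  rw [inv_mul_cancel] at happly
  have hT : T⁻¹ * A * T = upperSL u ((T⁻¹ * A * T).1 0 1) :=
    eq_upperSL_of_apply (by simpa using happly 0) (by simpa using happly 1)
  exact ⟨_, by rw [← hT]; group⟩

theorem exists_conj_upperSL_turnSL [IsAlgClosed K] {A B : SL(2, K)} {u : Kˣ}
    (hA : A.1.trace = u + (u⁻¹ : Kˣ)) (hB : B.1.trace = 0) (hAB : commTrace A B ≠ 0) :
    ∃ (c : K) (T : SL(2, K)), A = T * upperSL u c * T⁻¹ ∧ B = T * turnSL K * T⁻¹ := by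
  obtain ⟨v, hv, hAv⟩ := exists_mulVec_eq_smul hA
  have hdet := det_ne_zero_of_commTrace_ne_zero hB hAB hv hAv
  obtain ⟨e, he⟩ :=
    IsAlgClosed.exists_pow_nat_eq (Matrix.of ![v, B.1.mulVec v]).det⁻¹ two_pos
  let T : SL(2, K) := ⟨e • (Matrix.of ![v, B.1.mulVec v]).transpose, by
    rw [Matrix.det_smul, Matrix.det_transpose, Fintype.card_fin, he, inv_mul_cancel₀ hdet]⟩
  have hT0 (i : Fin 2) : T.1 i 0 = e * v i := rfl
  have hT1 (i : Fin 2) : T.1 i 1 = e * B.1.mulVec v i := rfl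
  have hcol {w : Fin 2 → K} {j : Fin 2} (h : ∀ i, T.1 i j = e * w i) (M : SL(2, K)) (i : Fin 2) :
      (M * T).1 i j = e * M.1.mulVec w i := by
    rw [coe_mul_SL2, Matrix.mul_apply, Fin.sum_univ_two, h, h, Matrix.mulVec, dotProduct,
      Fin.sum_univ_two]
    ring
  have hAT (i : Fin 2) : (A * T).1 i 0 = u * T.1 i 0 := by
    rw [hcol hT0, hAv, hT0, Pi.smul_apply, smul_eq_mul, mul_left_comm]
  have hBBv : B.1.mulVec (B.1.mulVec v) = -v := by
    rw [Matrix.mulVec_mulVec, mul_self_SL2, hB, zero_smul, zero_sub, Matrix.neg_mulVec,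
      Matrix.one_mulVec]
  have hBT : B * T = T * turnSL K := by
    ext i j
    fin_cases j
    · exact (hcol hT0 B i).trans (by simp [Matrix.mul_apply, coe_turnSL, hT1])
    · exact (hcol hT1 B i).trans (by rw [hBBv]; simp [Matrix.mul_apply, coe_turnSL, hT0])
  obtain ⟨c, hc⟩ := exists_eq_conj_upperSL hAT
  exact ⟨c, T, hc, by rw [← hBT, mul_inv_cancel_right]⟩

end CommonEigenvector

section PolynomialFamily

variable {R : Type*} [CommRing R]

/-- The generic matrix `[[u, X], [0, u⁻¹]]`, whose values are the matrices `upperSL u c`. -/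
noncomputable def polyUpper (u : Rˣ) : SL(2, R[X]) :=
  upperSL (Units.map C.toMonoidHom u) X

theorem map_eval_polyUpper (u : Rˣ) (c : R) :
    Matrix.SpecialLinearGroup.map (evalRingHom c) (polyUpper u) = upperSL u c := by
  rw [polyUpper, map_upperSL, coe_evalRingHom, eval_X]
  congr 1
  ext
  simp

theorem polyUpper_zpow (u : Rˣ) (r : ℤ) :
    ∃ U : R, U * (u - (u⁻¹ : Rˣ)) = (u ^ r : Rˣ) - ((u ^ r)⁻¹ : Rˣ) ∧
      polyUpper u ^ r = upperSL (Units.map C.toMonoidHom (u ^ r)) (C U * X) := by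
  induction r using Int.induction_on with
  | zero =>
    refine ⟨0, by simp, ?_⟩
    ext i j
    fin_cases i <;> fin_cases j <;> simp [coe_upperSL]
  | succ n ih =>
    obtain ⟨U, hU, hA⟩ := ih
    refine ⟨(u ^ (n : ℤ) : Rˣ) + U * (u⁻¹ : Rˣ), ?_, ?_⟩
    · rw [zpow_add_one, mul_inv_rev, Units.val_mul, Units.val_mul]
      linear_combination (u⁻¹ : Rˣ) * hU
    · rw [zpow_add_one, hA, polyUpper, upperSL_mul, ← map_mul, ← zpow_add_one]
      congr 1
      simp
      ring
  | pred n ih =>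
    obtain ⟨U, hU, hA⟩ := ih
    refine ⟨U * u - (u ^ (-(n : ℤ)) : Rˣ), ?_, ?_⟩
    · rw [zpow_sub_one, mul_inv_rev, inv_inv, Units.val_mul, Units.val_mul]
      linear_combination (u : R) * hU
    · rw [zpow_sub_one, hA, polyUpper, upperSL_inv, upperSL_mul, ← map_inv, ← map_mul,
        ← zpow_sub_one]
      congr 1
      simp
      ring

theorem exists_polyUpper_zpow_eq {u : Rˣ} {r : ℤ}
    (hr : polyUpper u ^ r ∉ Subgroup.center SL(2, R[X])) :
    ∃ U ≠ 0, polyUpper u ^ r = upperSL (Units.map C.toMonoidHom (u ^ r)) (C U * X) := by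
  obtain ⟨U, hU, hA⟩ := polyUpper_zpow u r
  refine ⟨U, ?_, hA⟩
  rintro rfl
  rw [zero_mul, eq_comm, sub_eq_zero] at hU
  refine hr (Matrix.SpecialLinearGroup.mem_center_iff.mpr ⟨C ((u ^ r : Rˣ) : R), ?_, ?_⟩)
  · rw [Fintype.card_fin, sq]
    nth_rewrite 2 [hU]
    rw [← C_mul, Units.mul_inv, C_1]
  · rw [hA, coe_upperSL, ← map_inv, Units.coe_map, Units.coe_map, ← hU]
    ext i j : 1
    fin_cases i <;> fin_cases j <;> simp [-map_zpow]

theorem upperSL_zpow_mem_center {u : Rˣ} {r : ℤ} (c : R)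
    (hr : polyUpper u ^ r ∈ Subgroup.center SL(2, R[X])) :
    upperSL u c ^ r ∈ Subgroup.center SL(2, R) := by
  rw [← map_eval_polyUpper, ← map_zpow]
  exact map_mem_center_SL2 _ hr

/-- The exponents of a reduced word: no power of the generic matrix that occurs is scalar. -/
def IsReduced (u : Rˣ) (rs : List ℤ) : Prop :=
  ∀ r ∈ rs, polyUpper u ^ r ∉ Subgroup.center SL(2, R[X])

/-- A matrix of polynomials of degrees at most `n` whose lower left entry has degree `n`: the shape
of the reduced alternating products in the generic matrix. -/
def LowerLeftDominant (V : Matrix (Fin 2) (Fin 2) R[X]) (n : ℕ) : Prop :=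
  (V 1 0).coeff n ≠ 0 ∧ ∀ i j, (V i j).natDegree ≤ n

theorem LowerLeftDominant.neg {V : Matrix (Fin 2) (Fin 2) R[X]} {n : ℕ}
    (hV : LowerLeftDominant V n) : LowerLeftDominant (-V) n :=
  ⟨by simpa using hV.1, fun i j => by simpa using hV.2 i j⟩

theorem LowerLeftDominant.turn_mul_upper_mul [IsDomain R] {V : Matrix (Fin 2) (Fin 2) R[X]} {n : ℕ}
    (hV : LowerLeftDominant V n) (v : Rˣ) {U : R} (hU : U ≠ 0) :
    LowerLeftDominant
      ((turnSL R[X]).1 * (upperSL (Units.map C.toMonoidHom v) (C U * X)).1 * V) (n + 1) := by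
  have hprod : (turnSL R[X]).1 * (upperSL (Units.map C.toMonoidHom v) (C U * X)).1 * V =
      !![-(C ((v⁻¹ : Rˣ) : R) * V 1 0), -(C ((v⁻¹ : Rˣ) : R) * V 1 1);
        C (v : R) * V 0 0 + C U * (X * V 1 0), C (v : R) * V 0 1 + C U * (X * V 1 1)] := by
    rw [coe_turnSL, coe_upperSL, ← map_inv]
    ext i j : 1
    fin_cases i <;> fin_cases j <;> simp [Matrix.mul_apply, mul_assoc]
  have hup (j : Fin 2) : natDegree (C ((v⁻¹ : Rˣ) : R) * V 1 j) ≤ n + 1 :=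
    (natDegree_C_mul_le _ _).trans ((hV.2 1 j).trans n.le_succ)
  have hlow (j : Fin 2) : natDegree (C (v : R) * V 0 j + C U * (X * V 1 j)) ≤ n + 1 := by
    refine natDegree_add_le_of_degree_le
      ((natDegree_C_mul_le _ _).trans ((hV.2 0 j).trans n.le_succ))
      ((natDegree_C_mul_le _ _).trans (natDegree_mul_le.trans ?_))
    rw [natDegree_X, add_comm]
    exact Nat.add_le_add_right (hV.2 1 j) 1
  rw [hprod]
  refine ⟨?_, fun i j => by fin_cases i <;> fin_cases j <;> simp [hup, hlow]⟩
  have h00 : (V 0 0).coeff (n + 1) = 0 :=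
    coeff_eq_zero_of_natDegree_lt (Nat.lt_succ_of_le (hV.2 0 0))
  have hcoeff : (C (v : R) * V 0 0 + C U * (X * V 1 0)).coeff (n + 1) =
      U * (V 1 0).coeff n := by
    rw [coeff_add, coeff_C_mul, h00, mul_zero, zero_add, coeff_C_mul, coeff_X_mul]
  exact hcoeff.trans_ne (mul_ne_zero hU hV.1)

theorem lowerLeftDominant_altProd [IsDomain R] {u : Rˣ} {rs : List ℤ} (hrs : IsReduced u rs)
    {s : ℤ} (hs : s = 1 ∨ s = -1) :
    LowerLeftDominant (altProd (polyUpper u) (turnSL R[X]) s rs).1 rs.length := by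
  induction rs generalizing s with
  | nil =>
    have hJ : LowerLeftDominant (turnSL R[X]).1 0 :=
      ⟨by simp [coe_turnSL], fun i j => by fin_cases i <;> fin_cases j <;> simp [coe_turnSL]⟩
    rcases hs with rfl | rfl
    · rwa [altProd, zpow_one]
    · rw [altProd, zpow_neg_one, coe_turnSL_inv]
      exact hJ.neg
  | cons r rs ih =>
    obtain ⟨U, hU, hA⟩ := exists_polyUpper_zpow_eq (hrs r List.mem_cons_self)
    have hV := (ih (fun i hi => hrs i (List.mem_cons_of_mem _ hi)) (s := -s)
      (by rcases hs with rfl | rfl <;> simp)).turn_mul_upper_mul (u ^ r) hU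
    rw [altProd, coe_mul_SL2, coe_mul_SL2, hA, List.length_cons]
    rcases hs with rfl | rfl
    · rwa [zpow_one]
    · rw [zpow_neg_one, coe_turnSL_inv, neg_mul, neg_mul]
      exact hV.neg

theorem LowerLeftDominant.commTrace_polyUpper_ne_zero [IsDomain R] (u : Rˣ) {V : SL(2, R[X])}
    {n : ℕ} (hV : LowerLeftDominant V.1 n) : commTrace (polyUpper u) V ≠ 0 := by
  rw [polyUpper, commTrace_upperSL, ← map_inv, Units.coe_map, Units.coe_map]
  refine mul_ne_zero (fun h0 => hV.1 (by rw [h0, coeff_zero])) (fun h0 => hV.1 ?_)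
  have hzero (i j : Fin 2) {k : ℕ} (hk : n < k) : (V.1 i j).coeff k = 0 :=
    coeff_eq_zero_of_natDegree_lt ((hV.2 i j).trans_lt hk)
  have htop := congrArg (fun p => coeff p (n + 2)) h0
  simp only [RingHom.toMonoidHom_eq_coe, MonoidHom.coe_coe, ← C_sub, ← C_pow, mul_assoc, coeff_zero,
    coeff_sub, coeff_add, coeff_X_pow_mul, coeff_X_mul, coeff_C_mul] at htop
  rwa [hzero 0 0 n.lt_succ_self, hzero 1 1 n.lt_succ_self, hzero 0 1 (by lia), sub_zero, mul_zero,
    mul_zero, sub_zero, add_zero] at htop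

theorem commTrace_altProd_ne_zero [IsDomain R] {u : Rˣ} {rs : List ℤ} (hrs : IsReduced u rs) :
    commTrace (polyUpper u) (altProd (polyUpper u) (turnSL R[X]) 1 rs) ≠ 0 :=
  (lowerLeftDominant_altProd hrs (Or.inl rfl)).commTrace_polyUpper_ne_zero u

theorem eval_commTrace_altProd (u : Rˣ) (rs : List ℤ) (c : R) :
    (commTrace (polyUpper u) (altProd (polyUpper u) (turnSL R[X]) 1 rs)).eval c =
      commTrace (upperSL u c) (altProd (upperSL u c) (turnSL R) 1 rs) := by
  rw [← coe_evalRingHom, ← commTrace_map, map_altProd, map_eval_polyUpper, map_turnSL]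

end PolynomialFamily

section ReducedWords

theorem beta_mk_upperSL (u : ℂˣ) (c : ℂ) :
    beta (QuotientGroup.mk (upperSL u c)) = (u - (u⁻¹ : ℂˣ)) ^ 2 := by
  rw [beta_mk, trace_upperSL]
  linear_combination 4 * u.mul_inv

theorem eval_specialize_altProd (u : ℂˣ) (c : ℂ) {rs : List ℤ} {p : ℤ[X][X]}
    (hp : IsTracePolynomial (altProd (FreeGroup.of 0) (FreeGroup.of 1) 1 rs) p) :
    (specialize p ((u - (u⁻¹ : ℂˣ)) ^ 2)).eval ((u - (u⁻¹ : ℂˣ)) ^ 2 + c ^ 2) =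
      commTrace (upperSL u c) (altProd (upperSL u c) (turnSL ℂ) 1 rs) := by
  have h := hp (QuotientGroup.mk (upperSL u c)) (QuotientGroup.mk (turnSL ℂ))
  rw [beta_mk_upperSL, evalWord_altProd, ← mk_altProd] at h
  rw [← commTrace_upperSL_turnSL]
  exact h.symm

theorem exists_isRoot_specialize {u : ℂˣ} {c : ℂ} {rs : List ℤ} (hrs : IsReduced u rs)
    (h0 : commTrace (upperSL u c) (altProd (upperSL u c) (turnSL ℂ) 1 rs) = 0) :
    ∃ w, IsGoodWord w ∧ ∃ p, IsTracePolynomial w p ∧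
      specialize p ((u - (u⁻¹ : ℂˣ)) ^ 2) ≠ 0 ∧
      (specialize p ((u - (u⁻¹ : ℂˣ)) ^ 2)).IsRoot ((u - (u⁻¹ : ℂˣ)) ^ 2 + c ^ 2) := by
  obtain ⟨p, hp⟩ := exists_isTracePolynomial_altProd (Or.inl rfl) rs
  refine ⟨_, ⟨1, rs, Or.inl rfl, rfl⟩, p, hp, fun hp0 => ?_,
    (eval_specialize_altProd u c hp).trans h0⟩
  refine commTrace_altProd_ne_zero hrs (Polynomial.funext fun z => ?_)
  rw [eval_commTrace_altProd, ← eval_specialize_altProd u z hp, hp0, eval_zero, eval_zero]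

theorem isReduced_nil (u : ℂˣ) : IsReduced u [] := by
  simp [IsReduced]

theorem isReduced_singleton_one (u : ℂˣ) : IsReduced u [1] := by
  intro r hr hcenter
  obtain rfl := List.mem_singleton.mp hr
  rw [zpow_one] at hcenter
  obtain ⟨k, -, hk⟩ := Matrix.SpecialLinearGroup.mem_center_iff.mp hcenter
  have h01 : (0 : ℂ[X]) = X := by simpa [polyUpper, coe_upperSL] using congrFun (congrFun hk 0) 1
  exact X_ne_zero h01.symm

theorem commTrace_upperSL_zero_conj (u : ℂˣ) :
    commTrace (upperSL u 0) (altProd (upperSL u 0) (turnSL ℂ) 1 [1]) = 0 := by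
  have hword : (altProd (upperSL u 0) (turnSL ℂ) 1 [1]).1 =
      (turnSL ℂ).1 * (upperSL u 0).1 * -(turnSL ℂ).1 := by
    rw [← coe_turnSL_inv, ← coe_mul_SL2, ← coe_mul_SL2]
    simp only [altProd, zpow_one, zpow_neg]
  rw [commTrace_upperSL, hword]
  simp [coe_turnSL, coe_upperSL]

end ReducedWords

/-! ### The trace estimate -/

section OmittedSegment

open Metric

theorem norm_sub_div_add_conj_le_one {a b : ℂ} (ha : 0 < a.re) (hb : 0 < b.re) :
    ‖(a - b) / (a + (starRingEnd ℂ) b)‖ ≤ 1 := by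
  rw [norm_div]
  refine div_le_one_of_le₀ ?_ (norm_nonneg _)
  rw [← sq_le_sq₀ (norm_nonneg _) (norm_nonneg _), ← Complex.normSq_eq_norm_sq,
    ← Complex.normSq_eq_norm_sq, Complex.normSq_apply, Complex.normSq_apply]
  simp only [Complex.sub_re, Complex.sub_im, Complex.add_re, Complex.add_im, Complex.conj_re,
    Complex.conj_im]
  linarith [mul_pos ha hb]

theorem norm_deriv_le_of_re_pos {R : ℂ → ℂ} {c : ℂ} {ρ : ℝ} (hρ : 0 < ρ)
    (hR : DifferentiableOn ℂ R (ball c ρ)) (hpos : ∀ z ∈ ball c ρ, 0 < (R z).re) :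
    ‖deriv R c‖ ≤ 2 * (R c).re / ρ := by
  have hc : c ∈ ball c ρ := mem_ball_self hρ
  have hre := hpos c hc
  have hden (z : ℂ) (hz : z ∈ ball c ρ) : R z + (starRingEnd ℂ) (R c) ≠ 0 := fun h => by
    have hzero := congrArg Complex.re h
    simp only [Complex.add_re, Complex.conj_re, Complex.zero_re] at hzero
    linarith [hpos z hz]
  -- The Cayley transform carries the right half-plane to the unit disc and `R c` to `0`.
  let φ : ℂ → ℂ := fun z => (R z - R c) / (R z + (starRingEnd ℂ) (R c))
  have hmaps : Set.MapsTo φ (ball c ρ) (closedBall (φ c) 1) := fun z hz => by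
    rw [show φ c = 0 by simp [φ], mem_closedBall_zero_iff]
    exact norm_sub_div_add_conj_le_one (hpos z hz) hre
  have hschwarz : ‖deriv φ c‖ ≤ 1 / ρ := Complex.norm_deriv_le_div_of_mapsTo_ball
    ((hR.sub_const _).div (hR.add_const _) hden) hmaps hρ
  have hRc : HasDerivAt R (deriv R c) c :=
    (hR.differentiableAt (isOpen_ball.mem_nhds hc)).hasDerivAt
  have hφ : deriv φ c = deriv R c / ((2 * (R c).re : ℝ) : ℂ) := by
    have h2 : ((2 * (R c).re : ℝ) : ℂ) ≠ 0 := Complex.ofReal_ne_zero.mpr (by positivity)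
    have hderiv := ((hRc.sub_const (R c)).div (hRc.add_const ((starRingEnd ℂ) (R c)))
      (hden c hc)).deriv
    rw [Complex.add_conj, sub_self, zero_mul, sub_zero] at hderiv
    refine hderiv.trans ?_
    field_simp
  rw [hφ, norm_div, Complex.norm_real, Real.norm_of_nonneg (by positivity),
    div_le_iff₀ (by positivity), one_div_mul_eq_div] at hschwarz
  exact hschwarz

theorem re_exp_half_log_pos {z : ℂ} (hz : z ∈ Complex.slitPlane) :
    0 < (Complex.exp (Complex.log z / 2)).re := by
  have hπ := lt_of_le_of_ne (Complex.arg_le_pi z) (Complex.mem_slitPlane_iff_arg.mp hz).1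
  have hnegπ := Complex.neg_pi_lt_arg z
  rw [Complex.exp_re, Complex.div_ofNat_im, Complex.log_im]
  exact mul_pos (Real.exp_pos _) (Real.cos_pos_of_mem_Ioo ⟨by linarith, by linarith⟩)

theorem norm_deriv_le_of_mapsTo_slitPlane {S : ℂ → ℂ} {c : ℂ} {ρ : ℝ} (hρ : 0 < ρ)
    (hS : DifferentiableOn ℂ S (ball c ρ)) (hslit : ∀ z ∈ ball c ρ, S z ∈ Complex.slitPlane) :
    ‖deriv S c‖ ≤ 4 * ‖S c‖ / ρ := by
  have hc : c ∈ ball c ρ := mem_ball_self hρ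
  let R : ℂ → ℂ := fun z => Complex.exp (Complex.log (S z) / 2)
  have hR : DifferentiableOn ℂ R (ball c ρ) := ((hS.clog hslit).div_const 2).cexp
  have hsq (z : ℂ) (hz : z ∈ ball c ρ) : R z ^ 2 = S z := by
    rw [← Complex.exp_nat_mul, Nat.cast_ofNat, mul_div_cancel₀ _ two_ne_zero,
      Complex.exp_log (Complex.slitPlane_ne_zero (hslit z hz))]
  have hderiv : deriv S c = 2 * R c * deriv R c := by
    have hRc := (hR.differentiableAt (isOpen_ball.mem_nhds hc)).hasDerivAt.pow 2
    have hSR : S =ᶠ[𝓝 c] R ^ 2 :=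
      eventually_of_mem (isOpen_ball.mem_nhds hc) fun z hz => (hsq z hz).symm
    rw [hSR.deriv_eq, hRc.deriv]
    norm_num
  have hbound : ‖deriv R c‖ ≤ 2 * ‖R c‖ / ρ :=
    (norm_deriv_le_of_re_pos hρ hR fun z hz => re_exp_half_log_pos (hslit z hz)).trans
      (by gcongr; exact Complex.re_le_norm _)
  calc ‖deriv S c‖ = 2 * ‖R c‖ * ‖deriv R c‖ := by
        rw [hderiv, norm_mul, norm_mul, Complex.norm_ofNat]
    _ ≤ 2 * ‖R c‖ * (2 * ‖R c‖ / ρ) := by gcongr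
    _ = 4 * ‖S c‖ / ρ := by rw [← hsq c hc, norm_pow]; ring

theorem sub_two_div_add_two_mem_slitPlane {t : ℂ} (ht : ∀ s : ℝ, |s| ≤ 2 → t ≠ s) :
    (t - 2) / (t + 2) ∈ Complex.slitPlane := by
  have hne : t + 2 ≠ 0 := fun h => ht (-2) (by norm_num) (by push_cast; linear_combination h)
  by_contra hmem
  rw [Complex.mem_slitPlane_iff, not_or, not_lt, not_not] at hmem
  set x := ((t - 2) / (t + 2)).re
  have hx : t - 2 = x * (t + 2) :=
    (div_eq_iff hne).mp (Complex.ext (Complex.ofReal_re x).symm (by simpa using hmem.2))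
  have hx1 : 0 < 1 - x := by linarith
  refine ht (2 * (1 + x) / (1 - x)) ?_ ?_
  · rw [abs_le, div_le_iff₀ hx1, le_div_iff₀ hx1]
    constructor <;> linarith
  · have hx1' : 1 - (x : ℂ) ≠ 0 := by exact_mod_cast hx1.ne'
    push_cast
    rw [eq_div_iff hx1']
    linear_combination hx

theorem norm_deriv_le_of_omits_segment {T : ℂ → ℂ} {c : ℂ} {ρ : ℝ} (hρ : 0 < ρ)
    (hT : DifferentiableOn ℂ T (ball c ρ))
    (homit : ∀ z ∈ ball c ρ, ∀ s : ℝ, |s| ≤ 2 → T z ≠ s) :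
    ‖deriv T c‖ ≤ ‖T c ^ 2 - 4‖ / ρ := by
  have hc : c ∈ ball c ρ := mem_ball_self hρ
  have hne (z : ℂ) (hz : z ∈ ball c ρ) : T z + 2 ≠ 0 := fun h =>
    homit z hz (-2) (by norm_num) (by push_cast; linear_combination h)
  have hbound := norm_deriv_le_of_mapsTo_slitPlane hρ
    ((hT.sub_const 2).div (hT.add_const 2) hne)
    fun z hz => sub_two_div_add_two_mem_slitPlane (homit z hz)
  have hTc := (hT.differentiableAt (isOpen_ball.mem_nhds hc)).hasDerivAt
  have hderiv := ((hTc.sub_const 2).div (hTc.add_const 2) (hne c hc)).deriv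
  have hpos : 0 < ‖T c + 2‖ := norm_pos_iff.mpr (hne c hc)
  have hnum : deriv T c * (T c + 2) - (T c - 2) * deriv T c = 4 * deriv T c := by ring
  rw [hderiv, hnum] at hbound
  simp only [Pi.div_apply, norm_div, norm_mul, norm_pow, Complex.norm_ofNat] at hbound
  calc ‖deriv T c‖ = 4 * ‖deriv T c‖ / ‖T c + 2‖ ^ 2 * (‖T c + 2‖ ^ 2 / 4) := by field_simp
    _ ≤ 4 * (‖T c - 2‖ / ‖T c + 2‖) / ρ * (‖T c + 2‖ ^ 2 / 4) := by gcongr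
    _ = ‖T c - 2‖ * ‖T c + 2‖ / ρ := by field_simp
    _ = ‖T c ^ 2 - 4‖ / ρ := by rw [← norm_mul]; ring_nf

theorem exists_two_mul_cos_mem {V : Set ℂ} (hV : IsOpen V) {s : ℝ} (hs : |s| ≤ 2)
    (hsV : (s : ℂ) ∈ V) :
    ∃ p q : ℕ, 0 < p ∧ p < q ∧ ((2 * Real.cos (Real.pi * p / q) : ℝ) : ℂ) ∈ V := by
  have hW : IsOpen ((fun x : ℝ => ((2 * Real.cos (Real.pi * x) : ℝ) : ℂ)) ⁻¹' V) :=
    hV.preimage (by fun_prop)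
  have hπ := Real.pi_pos
  have hmem : Real.arccos (s / 2) / Real.pi ∈ closure (Set.Ioo (0 : ℝ) 1) := by
    rw [closure_Ioo zero_ne_one]
    exact ⟨div_nonneg (Real.arccos_nonneg _) hπ.le, (div_le_one hπ).mpr (Real.arccos_le_pi _)⟩
  obtain ⟨r, hr, hr0, hr1⟩ := Rat.isDenseEmbedding_coe_real.dense.exists_mem_open
    (hW.inter isOpen_Ioo) (mem_closure_iff.mp hmem _ hW (by
      obtain ⟨h1, h2⟩ := abs_le.mp hs
      rwa [Set.mem_preimage, mul_div_cancel₀ _ hπ.ne',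
        Real.cos_arccos (by linarith) (by linarith), mul_div_cancel₀ _ two_ne_zero]))
  have hnum : 0 < r.num := Rat.num_pos.mpr (by exact_mod_cast hr0)
  have hden : r.num < r.den := Rat.num_lt_denom_iff.mpr (by exact_mod_cast hr1)
  refine ⟨r.num.toNat, r.den, by lia, by lia, ?_⟩
  have hr_eq : (r.num.toNat : ℝ) / r.den = r := by
    rw [← Int.cast_natCast, Int.toNat_of_nonneg hnum.le]
    exact_mod_cast Rat.num_div_den r
  rwa [mul_div_assoc, hr_eq]

theorem isOpen_image_eval {P : Polynomial ℂ} (hP : P.natDegree ≠ 0) {V : Set ℂ} (hV : IsOpen V) :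
    IsOpen (P.eval '' V) := by
  have han : AnalyticOnNhd ℂ (fun z => P.eval z) Set.univ := fun z _ =>
    P.differentiable.analyticAt z
  rcases han.is_constant_or_isOpen isPreconnected_univ with ⟨w, hw⟩ | hopen
  · have hPw : P = Polynomial.C w := Polynomial.funext fun z => by simp [hw z (Set.mem_univ z)]
    exact absurd (hPw ▸ Polynomial.natDegree_C w) hP
  · exact hopen V (Set.subset_univ V) hV

theorem omits_segment_of_omits_cos {P : Polynomial ℂ} (hP : P.natDegree ≠ 0) {V : Set ℂ}
    (hV : IsOpen V) (homit : ∀ z ∈ V, ∀ p q : ℕ, 0 < p → p < q →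
      P.eval z ≠ ((2 * Real.cos (Real.pi * p / q) : ℝ) : ℂ)) :
    ∀ z ∈ V, ∀ s : ℝ, |s| ≤ 2 → P.eval z ≠ s := by
  intro z hz s hs hzs
  obtain ⟨p, q, hp, hpq, x, hx, hxpq⟩ :=
    exists_two_mul_cos_mem (isOpen_image_eval hP hV) hs ⟨z, hz, hzs⟩
  exact homit x hx p q hp hpq hxpq

end OmittedSegment

section Elliptic

theorem coe_pow_succ_SL2 {R : Type*} [CommRing R] (A : SL(2, R)) (n : ℕ) :
    (A ^ (n + 1)).1 = (Chebyshev.S R n).eval A.1.trace • A.1 -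
      (Chebyshev.S R (n - 1)).eval A.1.trace • 1 := by
  induction n with
  | zero => simp
  | succ n ih =>
    rw [pow_succ, coe_mul_SL2, ih, sub_mul, smul_mul_assoc, smul_mul_assoc, one_mul, mul_self_SL2,
      Nat.cast_succ, add_sub_cancel_right, Chebyshev.S_add_one, eval_sub, eval_mul, eval_X]
    module

theorem trace_pow_SL2 {R : Type*} [CommRing R] (A : SL(2, R)) (n : ℕ) :
    (A ^ n).1.trace = (Chebyshev.C R n).eval A.1.trace := by
  cases n with
  | zero => simp
  | succ n =>
    rw [coe_pow_succ_SL2, Matrix.trace_sub, Matrix.trace_smul, Matrix.trace_smul, Matrix.trace_one,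
      Chebyshev.C_eq_S_sub_X_mul_S, Nat.cast_succ, add_sub_cancel_right, Chebyshev.S_add_one]
    simp
    ring

theorem natDegree_chebyshev_C (n : ℕ) : (Chebyshev.C ℂ n).natDegree = n := by
  rw [Chebyshev.C_eq_two_mul_T_comp_half_mul_X, ← C_ofNat, natDegree_C_mul two_ne_zero,
    natDegree_comp, Chebyshev.natDegree_T, natDegree_C_mul_X _ (by simp)]
  simp

theorem natDegree_trace_pow (g : SL(2, ℂ[X])) (n : ℕ) :
    (g ^ n).1.trace.natDegree = n * g.1.trace.natDegree := by
  rw [trace_pow_SL2, ← Chebyshev.aeval_C (R := ℂ), ← comp_eq_aeval, natDegree_comp,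
    natDegree_chebyshev_C]

theorem pow_mem_center_of_trace_eq_cos {M : SL(2, ℂ)} {p q : ℕ} (hp : 0 < p) (hpq : p < q)
    (ht : M.1.trace = ((2 * Real.cos (Real.pi * p / q) : ℝ) : ℂ)) :
    M ^ q ∈ Subgroup.center SL(2, ℂ) := by
  obtain ⟨n, rfl⟩ := Nat.exists_eq_succ_of_ne_zero (hp.trans hpq).ne'
  have hq : ((n + 1 : ℕ) : ℝ) ≠ 0 := by positivity
  have hsin : Real.sin (Real.pi * p / (n + 1 : ℕ)) ≠ 0 := by
    refine (Real.sin_pos_of_pos_of_lt_pi (by positivity) ?_).ne'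
    rw [div_lt_iff₀ (by positivity)]
    exact mul_lt_mul_of_pos_left (by exact_mod_cast hpq) Real.pi_pos
  have hS : (Chebyshev.S ℂ n).eval M.1.trace = 0 := by
    have h := Chebyshev.S_two_mul_real_cos (Real.pi * p / (n + 1 : ℕ)) n
    have hpi : ((n : ℤ) + 1) * (Real.pi * p / (n + 1 : ℕ)) = p * Real.pi := by
      push_cast at hq ⊢
      field_simp
    rw [hpi, Real.sin_nat_mul_pi] at h
    rw [ht, ← Chebyshev.map_S Complex.ofRealHom, ← Complex.ofRealHom_eq_coe, eval_map_apply,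
      (mul_eq_zero.mp h).resolve_right hsin, map_zero]
  refine mem_center_of_coe_eq_smul_one (k := -(Chebyshev.S ℂ (n - 1)).eval M.1.trace) ?_
  rw [coe_pow_succ_SL2, hS, zero_smul, zero_sub, ← neg_smul]

theorem zpow_inv_mul_pow_notMem_center (u : ℂˣ) {g : SL(2, ℂ[X])} (hg : g.1.trace.natDegree ≠ 0)
    {q : ℕ} (hq : q ≠ 0) (r : ℤ) :
    (polyUpper u ^ r)⁻¹ * g ^ q ∉ Subgroup.center SL(2, ℂ[X]) := by
  intro hcen
  obtain ⟨U, -, hU⟩ := polyUpper_zpow u r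
  have hconst : (polyUpper u ^ r).1.trace = C (((u ^ r : ℂˣ) : ℂ) + ((u ^ r)⁻¹ : ℂˣ)) := by
    rw [hU, trace_upperSL, C_add, ← map_inv, Units.coe_map, Units.coe_map]
    rfl
  have hdeg := congrArg natDegree (trace_sq_eq_of_inv_mul_mem_center hcen)
  rw [hconst, ← C_pow, natDegree_C, natDegree_pow, natDegree_trace_pow] at hdeg
  exact mul_ne_zero two_ne_zero (mul_ne_zero hq hg) hdeg

theorem exists_isReduced_commTrace_eq_zero {u : ℂˣ} {g : SL(2, ℂ[X])}
    (hg : g ∈ Subgroup.closure {polyUpper u, turnSL ℂ[X]}) (hdeg : g.1.trace.natDegree ≠ 0) {z : ℂ}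
    {p q : ℕ} (hp : 0 < p) (hpq : p < q)
    (hz : g.1.trace.eval z = ((2 * Real.cos (Real.pi * p / q) : ℝ) : ℂ)) :
    ∃ rs, IsReduced u rs ∧
      commTrace (upperSL u z) (altProd (upperSL u z) (turnSL ℂ) 1 rs) = 0 := by
  let π := QuotientGroup.mk' (Subgroup.center SL(2, ℂ[X]))
  have hb : π (turnSL ℂ[X]) * π (turnSL ℂ[X]) = 1 := by
    rw [← map_mul]
    exact (QuotientGroup.eq_one_iff _).mpr
      (mul_self_mem_center_of_trace_eq_zero (by simp [coe_turnSL]))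
  have hx : π (g ^ q) ∈ Subgroup.closure {π (polyUpper u), π (turnSL ℂ[X])} := by
    have h := Subgroup.mem_map_of_mem π (pow_mem hg q)
    rwa [MonoidHom.map_closure, Set.image_pair] at h
  rcases hasReducedForm_of_mem_closure hb hx with ⟨r, hr⟩ | ⟨r, r', rs, hrs, hr⟩
  · rw [← map_zpow] at hr
    exact absurd (QuotientGroup.eq.mp hr.symm)
      (zpow_inv_mul_pow_notMem_center u hdeg (hp.trans hpq).ne' r)
  · refine ⟨rs, fun i hi hcen => hrs i hi ?_, ?_⟩
    · rw [← map_zpow]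
      exact (QuotientGroup.eq_one_iff _).mpr hcen
    · rw [← map_altProd, ← map_zpow, ← map_zpow, ← map_mul, ← map_mul] at hr
      have hcen := map_mem_center_SL2 (evalRingHom z) (QuotientGroup.eq.mp hr.symm)
      rw [map_mul, map_inv, map_mul, map_mul, map_zpow, map_zpow, map_altProd, map_eval_polyUpper,
        map_turnSL, map_pow] at hcen
      have hpow : Matrix.SpecialLinearGroup.map (evalRingHom z) g ^ q ∈ Subgroup.center SL(2, ℂ) :=
        pow_mem_center_of_trace_eq_cos hp hpq ((AddMonoidHom.map_trace _ _).symm.trans hz)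
      exact commTrace_eq_zero_of_mem_center
        ((inv_mem_iff (G := SL(2, ℂ))).mp ((Subgroup.mul_mem_cancel_right _ hpow).mp hcen))

theorem norm_eval_derivative_trace_le {u : ℂˣ} {c : ℂ} {ρ : ℝ} (hρ : 0 < ρ)
    (h0 : ∀ rs, IsReduced u rs → ∀ z ∈ Metric.ball c ρ,
      commTrace (upperSL u z) (altProd (upperSL u z) (turnSL ℂ) 1 rs) ≠ 0)
    {g : SL(2, ℂ[X])} (hg : g ∈ Subgroup.closure {polyUpper u, turnSL ℂ[X]}) :
    ‖(derivative g.1.trace).eval c‖ ≤ ρ⁻¹ * ‖g.1.trace.eval c ^ 2 - 4‖ := by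
  by_cases hdeg : g.1.trace.natDegree = 0
  · rw [derivative_of_natDegree_zero hdeg, eval_zero, norm_zero]
    positivity
  have homit := omits_segment_of_omits_cos hdeg (Metric.isOpen_ball (x := c) (ε := ρ))
    fun z hz p q hp hpq htr => by
      obtain ⟨rs, hrs, hzero⟩ := exists_isReduced_commTrace_eq_zero hg hdeg hp hpq htr
      exact h0 rs hrs z hz hzero
  rw [inv_mul_eq_div, ← Polynomial.deriv]
  exact norm_deriv_le_of_omits_segment hρ g.1.trace.differentiable.differentiableOn homit

end Elliptic

/-! ### Tangent spaces over dual numbers -/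

section TangentSpace

open scoped commutatorElement

variable {E : Type*} [NormedRing E]

theorem norm_one_add_pow_sub_le (a : E) (k : ℕ) :
    ‖(1 + a) ^ k - 1‖ ≤ (1 + ‖a‖) ^ k - 1 ∧
      ‖(1 + a) ^ k - 1 - k • a‖ ≤ (1 + ‖a‖) ^ k - 1 - k * ‖a‖ := by
  induction k with
  | zero => simp
  | succ k ih =>
    obtain ⟨hone, hlin⟩ := ih
    have hmul : ‖((1 + a) ^ k - 1) * a‖ ≤ ((1 + ‖a‖) ^ k - 1) * ‖a‖ :=
      (norm_mul_le _ _).trans (mul_le_mul_of_nonneg_right hone (norm_nonneg a))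
    constructor
    · have hsplit : (1 + a) ^ (k + 1) - 1 = ((1 + a) ^ k - 1) + ((1 + a) ^ k - 1) * a + a := by
        rw [pow_succ]
        noncomm_ring
      rw [hsplit, pow_succ]
      linarith [norm_add₃_le (a := (1 + a) ^ k - 1) (b := ((1 + a) ^ k - 1) * a) (c := a)]
    · have hsplit : (1 + a) ^ (k + 1) - 1 - (k + 1) • a =
          ((1 + a) ^ k - 1 - k • a) + ((1 + a) ^ k - 1) * a := by
        rw [pow_succ, add_smul, one_smul]
        noncomm_ring
      rw [hsplit, pow_succ]
      push_cast
      linarith [norm_add_le ((1 + a) ^ k - 1 - k • a) (((1 + a) ^ k - 1) * a)]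

theorem norm_one_add_pow_sub_linear_le (a : E) {k : ℕ} (hk : k * ‖a‖ ≤ 1) :
    ‖(1 + a) ^ k - 1 - k • a‖ ≤ (k * ‖a‖) ^ 2 := by
  have hpow : (1 + ‖a‖) ^ k ≤ Real.exp (k * ‖a‖) := by
    rw [Real.exp_nat_mul, add_comm]
    gcongr
    exact Real.add_one_le_exp _
  have hexp := Real.abs_exp_sub_one_sub_id_le (x := k * ‖a‖)
    (by rwa [abs_of_nonneg (by positivity)])
  linarith [(norm_one_add_pow_sub_le a k).2, le_abs_self (Real.exp (k * ‖a‖) - 1 - k * ‖a‖)]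

variable [NormedAlgebra ℝ E]

theorem norm_inv_smul_one_add_smul_pow_floor_sub_le {D : E} {t τ : ℝ} (ht : 0 < t) (hτ : 0 < τ)
    (htD : t * ‖D‖ ≤ 1) :
    ‖t⁻¹ • ((1 + τ • D) ^ ⌊t / τ⌋₊ - 1) - D‖ ≤ t * ‖D‖ ^ 2 + τ / t * ‖D‖ := by
  set k := ⌊t / τ⌋₊
  have hkle : k * τ ≤ t := (le_div_iff₀ hτ).mp (Nat.floor_le (by positivity))
  have hklt : t < (k + 1) * τ := (div_lt_iff₀ hτ).mp (Nat.lt_floor_add_one _)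
  have hnorm : k * ‖τ • D‖ ≤ t * ‖D‖ := by
    rw [norm_smul, Real.norm_of_nonneg hτ.le, ← mul_assoc]
    gcongr
  have hquad : ‖t⁻¹ • ((1 + τ • D) ^ k - 1 - k • τ • D)‖ ≤ t * ‖D‖ ^ 2 := by
    rw [norm_smul, norm_inv, Real.norm_of_nonneg ht.le, inv_mul_le_iff₀ ht]
    calc _ ≤ (k * ‖τ • D‖) ^ 2 := norm_one_add_pow_sub_linear_le _ (hnorm.trans htD)
      _ ≤ (t * ‖D‖) ^ 2 := by gcongr
      _ = t * (t * ‖D‖ ^ 2) := by ring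
  have hround : ‖(k * τ / t - 1) • D‖ ≤ τ / t * ‖D‖ := by
    rw [norm_smul, Real.norm_eq_abs, abs_sub_comm,
      abs_of_nonneg (sub_nonneg.mpr ((div_le_one ht).mpr hkle))]
    gcongr
    rw [one_sub_div ht.ne']
    gcongr
    linarith
  have hsplit : t⁻¹ • ((1 + τ • D) ^ k - 1) - D =
      t⁻¹ • ((1 + τ • D) ^ k - 1 - k • τ • D) + (k * τ / t - 1) • D := by
    rw [← Nat.cast_smul_eq_nsmul ℝ, smul_smul, smul_sub t⁻¹ _ ((k * τ) • D), smul_smul,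
      sub_smul, one_smul, inv_mul_eq_div]
    abel
  rw [hsplit]
  exact (norm_add_le _ _).trans (add_le_add hquad hround)

theorem exists_tendsto_nhdsGT_zero {X G : Type*} [PseudoMetricSpace X] [Nonempty G]
    {F : ℝ → G → X} {x : X} (h : ∀ ε > 0, ∀ᶠ t in 𝓝[>] (0 : ℝ), ∃ g, dist (F t g) x < ε) :
    ∃ u : ℝ → G, Tendsto (fun t => F t (u t)) (𝓝[>] 0) (𝓝 x) := by
  have hbdd (t : ℝ) : BddBelow (Set.range fun g => dist (F t g) x) :=
    ⟨0, Set.forall_mem_range.mpr fun _ => dist_nonneg⟩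
  have hnear (t : ℝ) (ht : 0 < t) : ∃ g, dist (F t g) x < (⨅ g, dist (F t g) x) + t :=
    exists_lt_of_ciInf_lt (lt_add_of_pos_right _ ht)
  choose! u hu using hnear
  refine ⟨u, Metric.tendsto_nhds.mpr fun ε hε => ?_⟩
  filter_upwards [h (ε / 2) (half_pos hε), Ioo_mem_nhdsGT (half_pos hε)] with t ⟨g, hg⟩ ht
  linarith [hu t ht.1, ciInf_le (hbdd t) g, ht.2]

variable {G : Type*} [Group G] {ψ : G →* E} {u v : ℝ → G} {X Y : E}

/-- The family `u t` in `G`, seen in `E` through `ψ`, leaves `1` at time `0` with velocity `X`. -/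
def HasTangent (ψ : G →* E) (u : ℝ → G) (X : E) : Prop :=
  Tendsto (fun t => t⁻¹ • (ψ (u t) - 1)) (𝓝[>] 0) (𝓝 X)

theorem HasTangent.tendsto_one (hu : HasTangent ψ u X) :
    Tendsto (fun t => ψ (u t)) (𝓝[>] 0) (𝓝 1) := by
  have hid : Tendsto (fun t : ℝ => t) (𝓝[>] 0) (𝓝 0) := nhdsWithin_le_nhds
  have h := (hid.smul hu).add_const (1 : E)
  rw [zero_smul, zero_add] at h
  refine h.congr' ?_
  filter_upwards [self_mem_nhdsWithin] with t (ht : 0 < t)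
  rw [smul_inv_smul₀ ht.ne', sub_add_cancel]

theorem HasTangent.tendsto_inv_one [CompleteSpace E] (hu : HasTangent ψ u X) :
    Tendsto (fun t => ψ (u t)⁻¹) (𝓝[>] 0) (𝓝 1) := by
  have h := (NormedRing.inverse_continuousAt (1 : Eˣ)).tendsto.comp hu.tendsto_one
  rw [Units.val_one, Ring.inverse_one] at h
  exact h.congr fun t => Ring.inverse_unit (Units.map ψ (toUnits (u t)))

theorem hasTangent_one : HasTangent ψ (fun _ => 1) 0 := by
  simp [HasTangent]

theorem HasTangent.mul (hu : HasTangent ψ u X) (hv : HasTangent ψ v Y) :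
    HasTangent ψ (fun t => u t * v t) (X + Y) := by
  have h := (Tendsto.mul hu hv.tendsto_one).add hv
  rw [mul_one] at h
  refine h.congr fun t => ?_
  rw [map_mul, smul_mul_assoc, ← smul_add, sub_mul, one_mul, sub_add_sub_cancel]

theorem HasTangent.inv [CompleteSpace E] (hu : HasTangent ψ u X) :
    HasTangent ψ (fun t => (u t)⁻¹) (-X) := by
  have h := (hu.tendsto_inv_one.mul hu).neg
  rw [one_mul] at h
  refine h.congr fun t => ?_
  rw [mul_smul_comm, mul_sub, ← map_mul, inv_mul_cancel, map_one, mul_one, ← smul_neg, neg_sub]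

theorem HasTangent.comp_mul_left (hu : HasTangent ψ u X) {s : ℝ} (hs : 0 < s) :
    HasTangent ψ (fun t => u (s * t)) (s • X) := by
  have hmul : Tendsto (fun t : ℝ => s * t) (𝓝[>] 0) (𝓝[>] 0) :=
    tendsto_nhdsWithin_iff.mpr ⟨tendsto_nhdsWithin_of_tendsto_nhds
      (by simpa using (continuous_const_mul s).tendsto 0),
      eventually_nhdsWithin_of_forall fun _ => mul_pos hs⟩
  refine ((Tendsto.comp hu hmul).const_smul s).congr fun t => ?_
  simp only [Function.comp_apply]
  rw [smul_smul, mul_inv, mul_inv_cancel_left₀ hs.ne']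

theorem HasTangent.commutator [CompleteSpace E] (hu : HasTangent ψ u X) (hv : HasTangent ψ v Y) :
    HasTangent ψ (fun t => ⁅u √t, v √t⁆) (X * Y - Y * X) := by
  have hsqrt : Tendsto Real.sqrt (𝓝[>] 0) (𝓝[>] 0) :=
    tendsto_nhdsWithin_iff.mpr ⟨tendsto_nhdsWithin_of_tendsto_nhds
      (by simpa using Real.continuous_sqrt.tendsto 0),
      eventually_nhdsWithin_of_forall fun _ => Real.sqrt_pos.mpr⟩
  have h := (((((Tendsto.mul hu hv).sub (Tendsto.mul hv hu)).mul hu.tendsto_inv_one).mul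
    hv.tendsto_inv_one)).comp hsqrt
  rw [mul_one, mul_one] at h
  refine h.congr' ?_
  filter_upwards [self_mem_nhdsWithin] with t (ht : 0 < t)
  have hinv : (√t)⁻¹ * (√t)⁻¹ = t⁻¹ := by rw [← mul_inv, Real.mul_self_sqrt ht.le]
  have hcancel : ψ (v √t) * ψ (u √t) * ψ (u √t)⁻¹ * ψ (v √t)⁻¹ = 1 := by
    simp only [← map_mul]
    rw [mul_inv_cancel_right, mul_inv_cancel, map_one]
  have hcomm (a b : E) : (a - 1) * (b - 1) - (b - 1) * (a - 1) = a * b - b * a := by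
    noncomm_ring
  simp only [Function.comp_apply, smul_mul_assoc, mul_smul_comm, smul_smul, hinv, ← smul_sub]
  rw [hcomm, sub_mul, sub_mul, hcancel, commutatorElement_def, map_mul, map_mul, map_mul]

theorem HasTangent.conj (hu : HasTangent ψ u X) (g : G) :
    HasTangent ψ (fun t => g * u t * g⁻¹) (ψ g * X * ψ g⁻¹) := by
  refine ((Tendsto.const_mul (ψ g) hu).mul_const (ψ g⁻¹)).congr fun t => ?_
  rw [mul_smul_comm, smul_mul_assoc, mul_sub, sub_mul, mul_one, ← map_mul ψ g g⁻¹,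
    mul_inv_cancel, map_one, map_mul, map_mul]

/-- The real vector space of the velocities at `1` of families in the image of `ψ : G →* E`. The
families need not be continuous, so this is the Lie algebra of the closure of the image. -/
def tangentSpace [CompleteSpace E] (ψ : G →* E) : Submodule ℝ E where
  carrier := {X | ∃ u, HasTangent ψ u X}
  zero_mem' := ⟨_, hasTangent_one⟩
  add_mem' := fun ⟨_, hu⟩ ⟨_, hv⟩ => ⟨_, hu.mul hv⟩
  smul_mem' s X := fun ⟨u, hu⟩ => by
    rcases lt_trichotomy s 0 with hs | rfl | hs
    · rw [← neg_neg (s • X), ← neg_smul]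
      exact ⟨_, (hu.comp_mul_left (neg_pos.mpr hs)).inv⟩
    · rw [zero_smul]
      exact ⟨_, hasTangent_one⟩
    · exact ⟨_, hu.comp_mul_left hs⟩

variable [CompleteSpace E]

theorem mul_sub_mul_mem_tangentSpace (hX : X ∈ tangentSpace ψ) (hY : Y ∈ tangentSpace ψ) :
    X * Y - Y * X ∈ tangentSpace ψ := by
  obtain ⟨u, hu⟩ := hX
  obtain ⟨v, hv⟩ := hY
  exact ⟨_, hu.commutator hv⟩

theorem conj_mem_tangentSpace (hX : X ∈ tangentSpace ψ) (g : G) :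
    ψ g * X * ψ g⁻¹ ∈ tangentSpace ψ := by
  obtain ⟨u, hu⟩ := hX
  exact ⟨_, hu.conj g⟩

theorem map_eq_zero_of_mem_tangentSpace {F : Type*} [NormedAddCommGroup F] [NormedSpace ℝ F]
    {T : E →L[ℝ] F} (hT : ∀ g, T (ψ g⁻¹) = T (ψ g)) (hX : X ∈ tangentSpace ψ) : T X = 0 := by
  obtain ⟨u, hu⟩ := hX
  have h := (T.continuous.tendsto X).comp hu
  have hinv : T X = T (-X) := by
    refine tendsto_nhds_unique h (((T.continuous.tendsto (-X)).comp hu.inv).congr fun t => ?_)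
    simp only [Function.comp_apply, map_smul, map_sub, hT]
  have := IsAddTorsionFree.of_isTorsionFree ℝ F
  rwa [map_neg, self_eq_neg] at hinv

theorem mem_tangentSpace_of_seq {g : ℕ → G} {τ : ℕ → ℝ} (hτ : ∀ n, 0 < τ n)
    (hτ0 : Tendsto τ atTop (𝓝 0))
    (hg : Tendsto (fun n => (τ n)⁻¹ • (ψ (g n) - 1)) atTop (𝓝 X)) : X ∈ tangentSpace ψ := by
  refine exists_tendsto_nhdsGT_zero (F := fun t g => t⁻¹ • (ψ g - 1)) fun ε hε => ?_
  have hsmall {x δ : ℝ} (hδ : 0 < δ) : ∀ᶠ t in 𝓝[>] (0 : ℝ), t * x < δ := by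
    refine nhdsWithin_le_nhds (((continuous_mul_const x).tendsto 0).eventually_lt_const ?_)
    rwa [zero_mul]
  filter_upwards [hsmall one_pos, hsmall hε, self_mem_nhdsWithin] with t ht1 ht2 (ht : 0 < t)
  let D n := (τ n)⁻¹ • (ψ (g n) - 1)
  have hbound : Tendsto (fun n => t * ‖D n‖ ^ 2 + τ n / t * ‖D n‖ + ‖D n - X‖) atTop
      (𝓝 (t * ‖X‖ ^ 2 + 0 / t * ‖X‖ + ‖X - X‖)) :=
    (((hg.norm.pow 2).const_mul t).add ((hτ0.div_const t).mul hg.norm)).add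
      (hg.sub_const X).norm
  obtain ⟨n, hnD, hn⟩ := ((hg.norm.const_mul t).eventually_lt_const ht1 |>.and
    (hbound.eventually_lt_const (show _ < ε by simpa using ht2))).exists
  refine ⟨g n ^ ⌊t / τ n⌋₊, (dist_eq_norm _ _).trans_lt (lt_of_le_of_lt ?_ hn)⟩
  have hD : 1 + τ n • D n = ψ (g n) := by
    rw [smul_inv_smul₀ (hτ n).ne', add_sub_cancel]
  have hfloor := norm_inv_smul_one_add_smul_pow_floor_sub_le ht (hτ n) hnD.le
  rw [hD, ← map_pow] at hfloor
  exact (norm_sub_le_norm_sub_add_norm_sub _ (D n) _).trans (by gcongr)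

end TangentSpace

open scoped DualNumber

section DualNumber

variable {R : Type*} [NormedRing R] [NormedAlgebra ℝ R]

theorem norm_snd_pow_sub_le (x : R[ε]) (k : ℕ) :
    ‖(x ^ k).snd - (k : ℝ) • x.snd‖ ≤ k * ‖x.snd‖ * ((1 + ‖x.fst - 1‖) ^ k - 1) := by
  induction k with
  | zero => simp
  | succ k ih =>
    set a := x.fst - 1
    set d := x.snd
    set P := (1 + ‖a‖) ^ k
    have hsplit : (x ^ (k + 1)).snd - ((k + 1 : ℕ) : ℝ) • d =
        ((x ^ k).snd - (k : ℝ) • d) + (x ^ k).snd * a + (x.fst ^ k - 1) * d := by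
      rw [pow_succ, TrivSqZeroExt.snd_mul, TrivSqZeroExt.fst_pow, smul_eq_mul,
        op_smul_eq_mul, mul_sub, sub_mul, mul_one, one_mul, Nat.cast_succ, add_smul,
        one_smul]
      abel
    have hpow : ‖x.fst ^ k - 1‖ ≤ P - 1 := by
      simpa only [a, add_sub_cancel] using (norm_one_add_pow_sub_le a k).1
    have hsnd : ‖(x ^ k).snd‖ ≤ k * ‖d‖ * P := by
      have h := norm_sub_norm_le (x ^ k).snd ((k : ℝ) • d)
      rw [norm_smul, Real.norm_natCast] at h
      linarith
    have hP : 0 ≤ ‖d‖ * (P * ‖a‖) := by positivity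
    rw [hsplit]
    calc _ ≤ k * ‖d‖ * (P - 1) + k * ‖d‖ * P * ‖a‖ + (P - 1) * ‖d‖ :=
          norm_add₃_le.trans (add_le_add (add_le_add ih (norm_mul_le_of_le hsnd le_rfl))
            (norm_mul_le_of_le hpow le_rfl))
      _ ≤ _ := by
        rw [pow_succ]
        push_cast
        linarith

theorem natCast_mul_norm_snd_le_of_bounded {G : Type*} [Monoid G] {ψ : G →* R[ε]} {D : ℝ}
    (hD : ∀ g, ‖(ψ g).fst - 1‖ ≤ 1 → ‖(ψ g).snd‖ ≤ D) {g : G} {k : ℕ}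
    (hk : k * ‖(ψ g).fst - 1‖ ≤ 1 / 3) : k * ‖(ψ g).snd‖ ≤ 2 * D := by
  set α := ‖(ψ g).fst - 1‖
  have hkα : 0 ≤ k * α := by positivity
  have hpow : (1 + α) ^ k ≤ 3 / 2 := by
    have hexp := (abs_le.mp (Real.abs_exp_sub_one_sub_id_le (x := k * α)
      (abs_le.mpr ⟨by linarith, by linarith⟩))).2
    calc (1 + α) ^ k ≤ Real.exp α ^ k := by gcongr; linarith [Real.add_one_le_exp α]
      _ = Real.exp (k * α) := (Real.exp_nat_mul α k).symm
      _ ≤ 3 / 2 := by nlinarith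
  have hfst : ‖(ψ (g ^ k)).fst - 1‖ ≤ 1 := by
    have h := (norm_one_add_pow_sub_le ((ψ g).fst - 1) k).1
    rw [add_sub_cancel, ← TrivSqZeroExt.fst_pow, ← map_pow] at h
    exact h.trans (by linarith)
  have hrem := norm_snd_pow_sub_le (ψ g) k
  rw [← map_pow, norm_sub_rev] at hrem
  have htri := norm_sub_norm_le ((k : ℝ) • (ψ g).snd) (ψ (g ^ k)).snd
  rw [norm_smul, Real.norm_natCast] at htri
  have : k * ‖(ψ g).snd‖ * ((1 + α) ^ k - 1) ≤ k * ‖(ψ g).snd‖ * (1 / 2) := by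
    gcongr
    linarith
  linarith [hD _ hfst]

-- Apply the bound to `g ^ k`, whose derivative is about `k` times that of `g`.
theorem norm_snd_le_mul_of_bounded {G : Type*} [Monoid G] {ψ : G →* R[ε]} {D : ℝ}
    (hD : ∀ g, ‖(ψ g).fst - 1‖ ≤ 1 → ‖(ψ g).snd‖ ≤ D) {g : G} (hg : ‖(ψ g).fst - 1‖ ≤ 1 / 6) :
    ‖(ψ g).snd‖ ≤ 12 * D * ‖(ψ g).fst - 1‖ := by
  have hbound (k : ℕ) := natCast_mul_norm_snd_le_of_bounded hD (g := g) (k := k)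
  set α := ‖(ψ g).fst - 1‖
  have hα : 0 ≤ α := norm_nonneg _
  rcases hα.eq_or_lt with h0 | hpos
  · rw [← h0, mul_zero]
    by_contra! hne
    obtain ⟨k, hk⟩ := exists_nat_gt (2 * D / ‖(ψ g).snd‖)
    rw [div_lt_iff₀ hne] at hk
    linarith [hbound k (by rw [← h0]; norm_num)]
  · have hfloor := Nat.floor_le (show 0 ≤ 1 / (3 * α) by positivity)
    have hlt := Nat.lt_floor_add_one (1 / (3 * α))
    rw [le_div_iff₀ (by positivity)] at hfloor
    rw [div_lt_iff₀ (by positivity)] at hlt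
    have hk := hbound ⌊1 / (3 * α)⌋₊ (by linarith)
    have := norm_nonneg (ψ g).snd
    nlinarith

variable [CompleteSpace R] {G : Type*} [Group G] {ψ : G →* R[ε]} {r C : ℝ}

theorem norm_snd_le_of_mem_tangentSpace (hr : 0 < r)
    (hC : ∀ g, ‖(ψ g).fst - 1‖ ≤ r → ‖(ψ g).snd‖ ≤ C * ‖(ψ g).fst - 1‖) {X : R[ε]}
    (hX : X ∈ tangentSpace ψ) : ‖X.snd‖ ≤ C * ‖X.fst‖ := by
  obtain ⟨u, hu⟩ := hX
  have hfst := ((TrivSqZeroExt.continuous_fst.tendsto X).comp hu).norm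
  have hsnd := ((TrivSqZeroExt.continuous_snd.tendsto X).comp hu).norm
  have hone := (((TrivSqZeroExt.continuous_fst.tendsto _).comp hu.tendsto_one).sub_const 1).norm
  rw [TrivSqZeroExt.fst_one, sub_self, norm_zero] at hone
  refine le_of_tendsto_of_tendsto hsnd (hfst.const_mul C) ?_
  filter_upwards [hone.eventually_lt_const hr] with t ht
  have h := hC (u t) ht.le
  simp only [Function.comp_apply, TrivSqZeroExt.snd_smul, TrivSqZeroExt.fst_smul,
    TrivSqZeroExt.snd_sub, TrivSqZeroExt.fst_sub, TrivSqZeroExt.snd_one, TrivSqZeroExt.fst_one,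
    sub_zero, norm_smul]
  calc ‖t⁻¹‖ * ‖(ψ (u t)).snd‖ ≤ ‖t⁻¹‖ * (C * ‖(ψ (u t)).fst - 1‖) := by gcongr
    _ = _ := by ring

theorem exists_mem_tangentSpace_fst_ne_zero [FiniteDimensional ℝ R] (hr : 0 < r)
    (hC : ∀ g, ‖(ψ g).fst - 1‖ ≤ r → ‖(ψ g).snd‖ ≤ C * ‖(ψ g).fst - 1‖)
    (hacc : ∀ δ > 0, ∃ g, (ψ g).fst ≠ 1 ∧ ‖(ψ g).fst - 1‖ < δ) :
    ∃ X ∈ tangentSpace ψ, X.fst ≠ 0 := by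
  choose g hg1 hg using fun n : ℕ => hacc (min r (1 / ((n : ℝ) + 1))) (by positivity)
  have hlim : Tendsto (fun n => ‖(ψ (g n)).fst - 1‖) atTop (𝓝 0) :=
    squeeze_zero (fun _ => norm_nonneg _) (fun n => ((hg n).trans_le (min_le_right _ _)).le)
      tendsto_one_div_add_atTop_nhds_zero_nat
  set τ : ℕ → ℝ := fun n => ‖ψ (g n) - 1‖
  have hτ (n : ℕ) : 0 < τ n :=
    norm_pos_iff.mpr (sub_ne_zero.mpr fun h => hg1 n (by rw [h, TrivSqZeroExt.fst_one]))
  have hτ0 : Tendsto τ atTop (𝓝 0) := by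
    have h := hlim.const_mul (1 + C)
    rw [mul_zero] at h
    refine squeeze_zero (fun n => (hτ n).le) (fun n => ?_) h
    simp only [τ]
    rw [TrivSqZeroExt.norm_def, TrivSqZeroExt.fst_sub, TrivSqZeroExt.snd_sub,
      TrivSqZeroExt.fst_one, TrivSqZeroExt.snd_one, sub_zero, add_mul, one_mul]
    gcongr
    exact hC _ ((hg n).trans_le (min_le_left _ _)).le
  have : FiniteDimensional ℝ R[ε] := inferInstanceAs (FiniteDimensional ℝ (R × R))
  have : ProperSpace R[ε] := FiniteDimensional.proper_real R[ε]
  obtain ⟨X, hX, φ, hφ, hlimX⟩ := (isCompact_sphere (0 : R[ε]) 1).tendsto_subseq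
    (x := fun n => (τ n)⁻¹ • (ψ (g n) - 1)) fun n => by
      rw [mem_sphere_zero_iff_norm, norm_smul, norm_inv, Real.norm_of_nonneg (hτ n).le,
        inv_mul_cancel₀ (hτ n).ne']
  have hmem : X ∈ tangentSpace ψ := mem_tangentSpace_of_seq (g := g ∘ φ) (τ := τ ∘ φ)
    (fun n => hτ _) (hτ0.comp hφ.tendsto_atTop) hlimX
  refine ⟨X, hmem, fun h0 => ?_⟩
  have hsnd := norm_snd_le_of_mem_tangentSpace hr hC hmem
  rw [mem_sphere_zero_iff_norm, TrivSqZeroExt.norm_def, h0, norm_zero, zero_add] at hX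
  rw [h0, norm_zero, mul_zero, hX] at hsnd
  exact absurd hsnd (by norm_num)

end DualNumber

/-! ### Rigidity -/

section FormOfSl

open Matrix

variable {n K : Type*} [Fintype n] [Field K]

theorem trace_mulLeftRight (P Q : Matrix n n K) :
    LinearMap.trace K _ (LinearMap.mulLeftRight K (P, Q)) = P.trace * Q.trace := by
  classical
  rw [LinearMap.trace_eq_matrix_trace K (Matrix.stdBasis K n n), Matrix.trace,
    Fintype.sum_prod_type, Matrix.trace, Matrix.trace, Finset.sum_mul_sum]
  refine Finset.sum_congr rfl fun i _ => Finset.sum_congr rfl fun j _ => ?_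
  rw [Matrix.diag_apply, LinearMap.toMatrix_apply, Matrix.stdBasis_eq_single,
    LinearMap.mulLeftRight_apply, Matrix.stdBasis, Module.Basis.map_repr]
  simp [Matrix.mul_apply, Matrix.single_apply, ite_and]

variable [DecidableEq n]

theorem trace_mul_trace_add_eq_zero_of_bijective {L : Submodule K (Matrix n n K)[ε]}
    (hL : Function.Bijective fun X : L => X.1.fst) {A B : (Matrix n n K)[ε]}
    (hAB : ∀ X ∈ L, A * X * B ∈ L) :
    A.fst.trace * B.snd.trace + A.snd.trace * B.fst.trace = 0 := by
  -- `X ↦ A X B` has trace `tr A * tr B` over `K[ε]`, and a matrix over `K` in a basis of `L`.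
  let s : Matrix n n K ≃ₗ[K] L := (LinearEquiv.ofBijective
    ((TrivSqZeroExt.fstHom K (Matrix n n K) (Matrix n n K)).toLinearMap ∘ₗ L.subtype) hL).symm
  have hs (x : Matrix n n K) : (s x).1.fst = x := s.symm_apply_apply x
  let d : Matrix n n K →ₗ[K] Matrix n n K :=
    (TrivSqZeroExt.sndHom (Matrix n n K) (Matrix n n K)).restrictScalars K ∘ₗ
      L.subtype ∘ₗ s.toLinearMap
  have hd (x : Matrix n n K) : d (A.fst * x * B.fst) =
      A.fst * x * B.snd + A.fst * d x * B.fst + A.snd * x * B.fst := by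
    have h : s (A.fst * x * B.fst) = ⟨A * s x * B, hAB _ (s x).2⟩ :=
      hL.1 (by simp only [TrivSqZeroExt.fst_mul, hs])
    have h' := congrArg (fun X : L => X.1.snd) h
    simp only [TrivSqZeroExt.snd_mul, TrivSqZeroExt.fst_mul, hs, smul_eq_mul, op_smul_eq_mul,
      add_mul] at h'
    rw [← add_assoc] at h'
    exact h'
  have hcomm : LinearMap.mulLeftRight K (A.fst, B.snd) + LinearMap.mulLeftRight K (A.snd, B.fst) =
      d * LinearMap.mulLeftRight K (A.fst, B.fst) -
        LinearMap.mulLeftRight K (A.fst, B.fst) * d := by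
    ext1 x
    simp only [LinearMap.add_apply, LinearMap.sub_apply, Module.End.mul_apply,
      LinearMap.mulLeftRight_apply, hd]
    abel
  rw [← trace_mulLeftRight, ← trace_mulLeftRight, ← map_add, hcomm, map_sub,
    LinearMap.trace_mul_comm, sub_self]

theorem trace_mul_trace_add_eq_zero [NeZero (Fintype.card n : K)]
    {L : Submodule K (Matrix n n K)[ε]} (hfst : ∀ x, (∃ X ∈ L, X.fst = x) ↔ x.trace = 0)
    (hinj : ∀ X ∈ L, X.fst = 0 → X = 0) {A B : (Matrix n n K)[ε]} (hone : A * B = 1)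
    (hAB : ∀ X ∈ L, A * X * B ∈ L) :
    A.fst.trace * B.snd.trace + A.snd.trace * B.fst.trace = 0 := by
  have hn : (Fintype.card n : K) ≠ 0 := NeZero.ne _
  let τ : (Matrix n n K)[ε] →ₗ[K] K := (Fintype.card n : K)⁻¹ •
    (Matrix.traceLinearMap n K K ∘ₗ (TrivSqZeroExt.fstHom K (Matrix n n K) _).toLinearMap)
  have hτ (X : (Matrix n n K)[ε]) : τ X = (Fintype.card n : K)⁻¹ * X.fst.trace := rfl
  have hmem (X : (Matrix n n K)[ε]) :
      X ∈ L.comap (LinearMap.id - τ.smulRight 1) ↔ X - τ X • 1 ∈ L := Iff.rfl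
  refine trace_mul_trace_add_eq_zero_of_bijective (L := L.comap (LinearMap.id - τ.smulRight 1))
    ⟨fun X Y hXY => ?_, fun x => ?_⟩ fun X hX => ?_
  · have h := (hmem _).mp (X - Y).2
    have h0 : (X - Y).1.fst = 0 := sub_eq_zero.mpr hXY
    rw [hτ, h0, Matrix.trace_zero, mul_zero, zero_smul, sub_zero] at h
    exact sub_eq_zero.mp (Subtype.ext (hinj _ h h0))
  · obtain ⟨Y, hY, hYx⟩ := (hfst (x - ((Fintype.card n : K)⁻¹ * x.trace) • 1)).mpr (by
      rw [Matrix.trace_sub, Matrix.trace_smul, Matrix.trace_one, smul_eq_mul, mul_right_comm,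
        inv_mul_cancel₀ hn, one_mul, sub_self])
    have hx : (Y + ((Fintype.card n : K)⁻¹ * x.trace) • 1).fst = x := by
      rw [TrivSqZeroExt.fst_add, hYx, TrivSqZeroExt.fst_smul, TrivSqZeroExt.fst_one, sub_add_cancel]
    exact ⟨⟨_, (hmem _).mpr (by rwa [hτ, hx, add_sub_cancel_right])⟩, hx⟩
  · have hone' : B.fst * A.fst = 1 := by
      rw [mul_eq_one_comm, ← TrivSqZeroExt.fst_mul, hone, TrivSqZeroExt.fst_one]
    have htr : τ (A * X * B) = τ X := by
      rw [hτ, hτ, TrivSqZeroExt.fst_mul, TrivSqZeroExt.fst_mul, Matrix.trace_mul_comm,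
        ← mul_assoc, hone', one_mul]
    have h := hAB _ ((hmem X).mp hX)
    rw [mul_sub, sub_mul, mul_smul_comm, smul_mul_assoc, mul_one, hone] at h
    rwa [hmem, htr]

end FormOfSl

section TangentGraph

variable {n K G : Type*} [Fintype n] [Field K] [Group G]

/-- The conjugation action of `G` on the traceless matrices, through `ρ`, is irreducible. -/
def AdIrreducible (ρ : G → Matrix n n K) : Prop :=
  ∀ N : Submodule K (Matrix n n K), (∀ x ∈ N, x.trace = 0) →
    (∀ g, ∀ x ∈ N, ρ g * x * ρ g⁻¹ ∈ N) → ∀ x ∈ N, x ≠ 0 → ∀ y, y.trace = 0 → y ∈ N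

theorem eq_zero_of_commute_traceless [CharZero K] [Nonempty n] {A : Matrix n n K}
    (hA : A.trace = 0) (h : ∀ x : Matrix n n K, x.trace = 0 → Commute x A) : A = 0 := by
  classical
  obtain ⟨k, rfl⟩ := Matrix.mem_range_scalar_of_commute_single fun i j hij =>
    h (Matrix.single i j 1) (Matrix.trace_single_eq_of_ne i j 1 hij)
  rw [Matrix.scalar_apply, Matrix.trace_diagonal, Finset.sum_const, Finset.card_univ,
    nsmul_eq_mul, mul_eq_zero_iff_left (Nat.cast_ne_zero.mpr Fintype.card_ne_zero)] at hA
  rw [hA, map_zero]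

theorem mem_span_complex_iff {V : Type*} [AddCommGroup V] [Module ℂ V] [Module ℝ V]
    [IsScalarTower ℝ ℂ V] {W : Submodule ℝ V} {Z : V} :
    Z ∈ Submodule.span ℂ (W : Set V) ↔ ∃ X ∈ W, ∃ Y ∈ W, Z = X + Complex.I • Y := by
  refine ⟨fun hZ => ?_, ?_⟩
  · induction hZ using Submodule.span_induction with
    | mem X hX => exact ⟨X, hX, 0, W.zero_mem, by rw [smul_zero, add_zero]⟩
    | zero => exact ⟨0, W.zero_mem, 0, W.zero_mem, by rw [smul_zero, add_zero]⟩
    | add Z Z' _ _ hZ hZ' =>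
      obtain ⟨X, hX, Y, hY, rfl⟩ := hZ
      obtain ⟨X', hX', Y', hY', rfl⟩ := hZ'
      exact ⟨_, W.add_mem hX hX', _, W.add_mem hY hY', by rw [smul_add]; abel⟩
    | smul z Z _ hZ =>
      obtain ⟨X, hX, Y, hY, rfl⟩ := hZ
      refine ⟨z.re • X - z.im • Y, W.sub_mem (W.smul_mem _ hX) (W.smul_mem _ hY),
        z.im • X + z.re • Y, W.add_mem (W.smul_mem _ hX) (W.smul_mem _ hY), ?_⟩
      simp only [← algebraMap_smul ℂ (_ : ℝ), Complex.coe_algebraMap]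
      conv_lhs => rw [← Complex.re_add_im z]
      match_scalars
      · ring
      · linear_combination z.im * Complex.I_mul_I
  · rintro ⟨X, hX, Y, hY, rfl⟩
    exact add_mem (Submodule.subset_span hX)
      (Submodule.smul_mem _ _ (Submodule.subset_span hY))

theorem lie_sub_I_smul_sub_I_smul {A : Type*} [Ring A] [Algebra ℂ A] {X Y X' Y' : A}
    (hX' : ⁅Y, X'⁆ = ⁅X, Y'⁆) (hY' : ⁅Y, Y'⁆ = -⁅X, X'⁆) :
    ⁅Y - Complex.I • X, Y' - Complex.I • X'⁆ = -(2 * Complex.I) • ⁅Y - Complex.I • X, X'⁆ := by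
  rw [Ring.lie_def, Ring.lie_def] at hX' hY'
  simp only [Ring.lie_def, sub_mul, mul_sub, smul_mul_assoc, mul_smul_comm, smul_sub, smul_smul,
    neg_mul, mul_assoc, Complex.I_mul_I]
  linear_combination (norm := module) hY' + Complex.I • hX'

variable [DecidableEq n]

/-- A real Lie algebra of traceless matrices over `ℂ[ε]`, stable under conjugation by `ψ`, on which
`ε = 0` is injective: it is the graph of a real-linear map from its `ε = 0` part. -/
structure IsTangentGraph (ψ : G → (Matrix n n ℂ)[ε]) (W : Submodule ℝ (Matrix n n ℂ)[ε]) :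
    Prop where
  trace_fst : ∀ X ∈ W, X.fst.trace = 0
  trace_snd : ∀ X ∈ W, X.snd.trace = 0
  eq_zero : ∀ X ∈ W, X.fst = 0 → X = 0
  lie_mem : ∀ X ∈ W, ∀ Y ∈ W, ⁅X, Y⁆ ∈ W
  conj_mem : ∀ X ∈ W, ∀ g, ψ g * X * ψ g⁻¹ ∈ W

namespace IsTangentGraph

variable {ψ : G → (Matrix n n ℂ)[ε]} {W : Submodule ℝ (Matrix n n ℂ)[ε]} {X Y : (Matrix n n ℂ)[ε]}

theorem eq_of_fst_eq (hW : IsTangentGraph ψ W) (hX : X ∈ W) (hY : Y ∈ W) (h : X.fst = Y.fst) :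
    X = Y :=
  sub_eq_zero.mp (hW.eq_zero _ (W.sub_mem hX hY) (sub_eq_zero.mpr h))

theorem exists_fst_eq (hW : IsTangentGraph ψ W) (hψ : AdIrreducible fun g => (ψ g).fst)
    (hX : X ∈ W) (hX0 : X.fst ≠ 0) (hY : Y ∈ W) (hYX : Y.fst = Complex.I • X.fst)
    {x : Matrix n n ℂ} (hx : x.trace = 0) : ∃ X' ∈ W, X'.fst = x := by
  let N : Submodule ℂ (Matrix n n ℂ) :=
    { carrier := {x | ∀ z : ℂ, ∃ X ∈ W, X.fst = z • x}
      zero_mem' := fun z => ⟨0, W.zero_mem, (smul_zero z).symm⟩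
      add_mem' := fun {x y} hx hy z => by
        obtain ⟨X, hX, hXx⟩ := hx z
        obtain ⟨Y, hY, hYy⟩ := hy z
        exact ⟨X + Y, W.add_mem hX hY, by rw [TrivSqZeroExt.fst_add, hXx, hYy, smul_add]⟩
      smul_mem' := fun w x hx z => by
        obtain ⟨X, hX, hXx⟩ := hx (z * w)
        exact ⟨X, hX, by rw [hXx, mul_smul]⟩ }
  have hN {y : Matrix n n ℂ} (hy : y ∈ N) : ∃ X ∈ W, X.fst = y := by
    simpa only [one_smul] using hy 1
  refine hN (hψ N (fun y hy => ?_) (fun g y hy z => ?_) X.fst (fun z => ?_) hX0 x hx)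
  · obtain ⟨X', hX', rfl⟩ := hN hy
    exact hW.trace_fst X' hX'
  · obtain ⟨X', hX', h⟩ := hy z
    refine ⟨_, hW.conj_mem X' hX' g, ?_⟩
    rw [TrivSqZeroExt.fst_mul, TrivSqZeroExt.fst_mul, h, mul_smul_comm, smul_mul_assoc]
  · refine ⟨z.re • X + z.im • Y, W.add_mem (W.smul_mem _ hX) (W.smul_mem _ hY), ?_⟩
    rw [TrivSqZeroExt.fst_add, TrivSqZeroExt.fst_smul, TrivSqZeroExt.fst_smul, hYX]
    conv_rhs => rw [← Complex.re_add_im z]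
    rw [add_smul, mul_smul, Complex.coe_smul, Complex.coe_smul]

theorem eq_I_smul [Nonempty n] (hW : IsTangentGraph ψ W)
    (hψ : AdIrreducible fun g => (ψ g).fst) (hX : X ∈ W) (hY : Y ∈ W)
    (hYX : Y.fst = Complex.I • X.fst) : Y = Complex.I • X := by
  by_cases hX0 : X.fst = 0
  · rw [hW.eq_zero X hX hX0, smul_zero]
    exact hW.eq_zero Y hY (by rw [hYX, hX0, smul_zero])
  set Z := Y - Complex.I • X with hZ
  have hZ0 : Z.fst = 0 := sub_eq_zero.mpr hYX
  suffices h : Z.snd = 0 from sub_eq_zero.mp (TrivSqZeroExt.ext hZ0 h)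
  have htr : Z.snd.trace = 0 := by
    rw [hZ, TrivSqZeroExt.snd_sub, TrivSqZeroExt.snd_smul, Matrix.trace_sub, Matrix.trace_smul,
      hW.trace_snd X hX, hW.trace_snd Y hY, smul_zero, sub_zero]
  refine eq_zero_of_commute_traceless htr fun x hx => ?_
  obtain ⟨X', hX', rfl⟩ := hW.exists_fst_eq hψ hX hX0 hY hYX hx
  obtain ⟨Y', hY', hYX'⟩ := hW.exists_fst_eq hψ hX hX0 hY hYX
    (x := Complex.I • X'.fst) (by rw [Matrix.trace_smul, hx, smul_zero])
  have hfst (A B : (Matrix n n ℂ)[ε]) : ⁅A, B⁆.fst = ⁅A.fst, B.fst⁆ := rfl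
  have hYX'' : ⁅Y, X'⁆ = ⁅X, Y'⁆ :=
    hW.eq_of_fst_eq (hW.lie_mem _ hY _ hX') (hW.lie_mem _ hX _ hY')
      (by rw [hfst, hfst, hYX, hYX']; simp only [Ring.lie_def, smul_mul_assoc, mul_smul_comm])
  have hYY' : ⁅Y, Y'⁆ = -⁅X, X'⁆ :=
    hW.eq_of_fst_eq (hW.lie_mem _ hY _ hY') (W.neg_mem (hW.lie_mem _ hX _ hX')) (by
      rw [hfst, TrivSqZeroExt.fst_neg, hfst, hYX, hYX', Ring.lie_def, Ring.lie_def]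
      simp only [smul_mul_smul_comm, Complex.I_mul_I, neg_one_smul]
      abel)
  -- `Z` and `Y' - I X'` are multiples of `ε`, so their product vanishes.
  have hZZ' : ⁅Z, Y' - Complex.I • X'⁆ = 0 := by
    have hZ0' : (Y' - Complex.I • X').fst = 0 := sub_eq_zero.mpr hYX'
    have hmul {A B : (Matrix n n ℂ)[ε]} (hA : A.fst = 0) (hB : B.fst = 0) : A * B = 0 :=
      TrivSqZeroExt.ext (by simp [hA]) (by simp [hA, hB])
    rw [Ring.lie_def, hmul hZ0 hZ0', hmul hZ0' hZ0, sub_zero]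
  have hZX' : -(2 * Complex.I) • ⁅Z, X'⁆ = 0 :=
    (lie_sub_I_smul_sub_I_smul hYX'' hYY').symm.trans hZZ'
  rw [smul_eq_zero_iff_right (neg_ne_zero.mpr (mul_ne_zero two_ne_zero Complex.I_ne_zero))] at hZX'
  have hsnd := congrArg TrivSqZeroExt.snd hZX'
  rw [Ring.lie_def, TrivSqZeroExt.snd_sub, TrivSqZeroExt.snd_mul, TrivSqZeroExt.snd_mul, hZ0,
    zero_smul, zero_add, MulOpposite.op_zero, zero_smul, add_zero, op_smul_eq_mul, smul_eq_mul,
    TrivSqZeroExt.snd_zero, sub_eq_zero] at hsnd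
  exact hsnd.symm

theorem trace_fst_of_mem_span (hW : IsTangentGraph ψ W) {Z : (Matrix n n ℂ)[ε]}
    (hZ : Z ∈ Submodule.span ℂ (W : Set (Matrix n n ℂ)[ε])) : Z.fst.trace = 0 := by
  obtain ⟨X, hX, Y, hY, rfl⟩ := mem_span_complex_iff.mp hZ
  rw [TrivSqZeroExt.fst_add, TrivSqZeroExt.fst_smul, Matrix.trace_add, Matrix.trace_smul,
    hW.trace_fst X hX, hW.trace_fst Y hY, smul_zero, add_zero]

theorem conj_mem_span (hW : IsTangentGraph ψ W) (g : G) {Z : (Matrix n n ℂ)[ε]}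
    (hZ : Z ∈ Submodule.span ℂ (W : Set (Matrix n n ℂ)[ε])) :
    ψ g * Z * ψ g⁻¹ ∈ Submodule.span ℂ (W : Set (Matrix n n ℂ)[ε]) := by
  obtain ⟨X, hX, Y, hY, rfl⟩ := mem_span_complex_iff.mp hZ
  refine mem_span_complex_iff.mpr ⟨_, hW.conj_mem X hX g, _, hW.conj_mem Y hY g, ?_⟩
  rw [mul_add, add_mul, mul_smul_comm, smul_mul_assoc]

theorem eq_zero_of_mem_span [Nonempty n] (hW : IsTangentGraph ψ W)
    (hψ : AdIrreducible fun g => (ψ g).fst) {Z : (Matrix n n ℂ)[ε]}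
    (hZ : Z ∈ Submodule.span ℂ (W : Set (Matrix n n ℂ)[ε])) (hZ0 : Z.fst = 0) : Z = 0 := by
  obtain ⟨X, hX, Y, hY, rfl⟩ := mem_span_complex_iff.mp hZ
  have hXY : X.fst = Complex.I • (-Y).fst := by
    rw [TrivSqZeroExt.fst_neg, smul_neg]
    exact eq_neg_of_add_eq_zero_left hZ0
  rw [hW.eq_I_smul hψ (W.neg_mem hY) hX hXY, smul_neg, neg_add_cancel]

theorem exists_mem_span_fst_eq (hW : IsTangentGraph ψ W)
    (hψ : AdIrreducible fun g => (ψ g).fst) (hX : X ∈ W) (hX0 : X.fst ≠ 0) {x : Matrix n n ℂ}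
    (hx : x.trace = 0) : ∃ Z ∈ Submodule.span ℂ (W : Set (Matrix n n ℂ)[ε]), Z.fst = x := by
  let p : (Matrix n n ℂ)[ε] →ₗ[ℂ] Matrix n n ℂ := (TrivSqZeroExt.fstHom ℂ _ _).toLinearMap
  refine hψ ((Submodule.span ℂ W).map p) ?_ ?_ X.fst
    (Submodule.mem_map_of_mem (f := p) (Submodule.subset_span hX)) hX0 x hx
  · rintro _ ⟨Z, hZ, rfl⟩
    exact hW.trace_fst_of_mem_span hZ
  · rintro g _ ⟨Z, hZ, rfl⟩
    exact ⟨_, hW.conj_mem_span g hZ, by simp only [p]; rfl⟩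

theorem trace_mul_trace_add_eq_zero [Nonempty n] (hW : IsTangentGraph ψ W)
    (hψ : AdIrreducible fun g => (ψ g).fst) (hX : X ∈ W) (hX0 : X.fst ≠ 0) {g : G}
    (hg : ψ g * ψ g⁻¹ = 1) :
    (ψ g).fst.trace * (ψ g⁻¹).snd.trace + (ψ g).snd.trace * (ψ g⁻¹).fst.trace = 0 :=
  TraceRoots.trace_mul_trace_add_eq_zero
    (fun _ => ⟨fun ⟨_, hZ, hZx⟩ => hZx ▸ hW.trace_fst_of_mem_span hZ,
      hW.exists_mem_span_fst_eq hψ hX hX0⟩)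
    (fun _ => hW.eq_zero_of_mem_span hψ) hg fun _ => hW.conj_mem_span g

end IsTangentGraph

end TangentGraph

section Rigidity

variable {n K G : Type*} [Fintype n] [DecidableEq n] [Field K] [Group G]

theorem AdIrreducible.span_eq_top [NeZero (Fintype.card n : K)] {ρ : G →* Matrix n n K}
    (hρ : AdIrreducible ρ) {g : G} (hg : ∀ k : K, ρ g ≠ k • 1) :
    Submodule.span K (Set.range ρ) = ⊤ := by
  set V := Submodule.span K (Set.range ρ)
  have hn : (Fintype.card n : K) ≠ 0 := NeZero.ne _
  have hone : (1 : Matrix n n K) ∈ V := Submodule.subset_span ⟨1, map_one ρ⟩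
  let t (x : Matrix n n K) : K := (Fintype.card n : K)⁻¹ * x.trace
  have ht (x : Matrix n n K) : (x - t x • 1).trace = 0 := by
    rw [Matrix.trace_sub, Matrix.trace_smul, Matrix.trace_one, smul_eq_mul, mul_right_comm,
      inv_mul_cancel₀ hn, one_mul, sub_self]
  have hconj (h : G) (x : Matrix n n K) (hx : x ∈ V) : ρ h * x * ρ h⁻¹ ∈ V := by
    induction hx using Submodule.span_induction with
    | mem x hx =>
      obtain ⟨k, rfl⟩ := hx
      exact Submodule.subset_span ⟨h * k * h⁻¹, by rw [map_mul, map_mul]⟩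
    | zero => rw [mul_zero, zero_mul]; exact V.zero_mem
    | add x y _ _ hx hy => rw [mul_add, add_mul]; exact V.add_mem hx hy
    | smul k x _ hx => rw [mul_smul_comm, smul_mul_assoc]; exact V.smul_mem k hx
  refine Submodule.eq_top_iff'.mpr fun x => ?_
  rw [← sub_add_cancel x (t x • 1)]
  refine V.add_mem (hρ (V ⊓ LinearMap.ker (Matrix.traceLinearMap n K K)) (fun _ hx => hx.2)
    (fun h x hx => ⟨hconj h x hx.1, ?_⟩) (ρ g - t (ρ g) • 1) ⟨V.sub_mem
      (Submodule.subset_span ⟨g, rfl⟩) (V.smul_mem _ hone), ht _⟩ (sub_ne_zero.mpr (hg _)) _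
      (ht x)).1 (V.smul_mem _ hone)
  rw [SetLike.mem_coe, LinearMap.mem_ker, Matrix.traceLinearMap_apply, Matrix.trace_mul_cycle,
    ← map_mul, inv_mul_cancel, map_one, one_mul]
  exact hx.2

attribute [local instance] Matrix.linftyOpNormedRing Matrix.linftyOpNormedAlgebra

theorem norm_le_sum_norm_apply (A : Matrix n n ℂ) : ‖A‖ ≤ ∑ i, ∑ j, ‖A i j‖ := by
  have h : ‖A‖₊ ≤ ∑ i, ∑ j, ‖A i j‖₊ := by
    rw [Matrix.linfty_opNNNorm_def]
    exact Finset.sup_le fun i _ =>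
      Finset.single_le_sum (f := fun i => ∑ j, ‖A i j‖₊) (fun _ _ => zero_le) (Finset.mem_univ i)
  simpa only [NNReal.coe_sum, coe_nnnorm] using NNReal.coe_le_coe.mpr h

theorem exists_norm_le_of_norm_trace_mul_le {ι : Type*} {A : ι → Matrix n n ℂ}
    {S : Set (Matrix n n ℂ)} (hS : Submodule.span ℂ S = ⊤)
    (hA : ∀ m ∈ S, ∃ B, ∀ i, ‖(A i * m).trace‖ ≤ B) : ∃ D, ∀ i, ‖A i‖ ≤ D := by
  have hbdd (m : Matrix n n ℂ) : ∃ B, ∀ i, ‖(A i * m).trace‖ ≤ B := by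
    induction (hS ▸ Submodule.mem_top : m ∈ Submodule.span ℂ S) using
      Submodule.span_induction with
    | mem m hm => exact hA m hm
    | zero => exact ⟨0, fun i => by simp⟩
    | add m m' _ _ hm hm' =>
      obtain ⟨B, hB⟩ := hm
      obtain ⟨B', hB'⟩ := hm'
      refine ⟨B + B', fun i => ?_⟩
      rw [mul_add, Matrix.trace_add]
      exact (norm_add_le _ _).trans (add_le_add (hB i) (hB' i))
    | smul k m _ hm =>
      obtain ⟨B, hB⟩ := hm
      refine ⟨‖k‖ * B, fun i => ?_⟩
      rw [mul_smul_comm, Matrix.trace_smul, norm_smul]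
      exact mul_le_mul_of_nonneg_left (hB i) (norm_nonneg k)
  choose B hB using fun k l : n => hbdd (Matrix.single l k 1)
  refine ⟨∑ k, ∑ l, B k l, fun i => (norm_le_sum_norm_apply _).trans
    (Finset.sum_le_sum fun k _ => Finset.sum_le_sum fun l _ => ?_)⟩
  simpa only [Matrix.trace_mul_single, MulOpposite.op_one, one_smul] using hB k l i

theorem exists_norm_snd_le {ψ : G →* (Matrix n n ℂ)[ε]}
    (hspan : Submodule.span ℂ (Set.range fun g => (ψ g).fst) = ⊤) {F : Matrix n n ℂ → ℝ}
    (hF : Continuous F) (hψ : ∀ g, ‖(ψ g).snd.trace‖ ≤ F (ψ g).fst) :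
    ∃ D, ∀ g, ‖(ψ g).fst - 1‖ ≤ 1 → ‖(ψ g).snd‖ ≤ D := by
  obtain ⟨D, hD⟩ := exists_norm_le_of_norm_trace_mul_le
    (A := fun g : {g // ‖(ψ g).fst - 1‖ ≤ 1} => (ψ g).snd) hspan (by
      rintro _ ⟨h, rfl⟩
      have : ProperSpace (Matrix n n ℂ) := FiniteDimensional.proper ℂ _
      obtain ⟨C, hC⟩ := (isCompact_closedBall (1 : Matrix n n ℂ) 1).bddAbove_image
        (f := fun x => F (x * (ψ h).fst) + ‖(x * (ψ h).snd).trace‖) (by fun_prop)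
      refine ⟨C, fun ⟨g, hg⟩ => ?_⟩
      have hgh := hψ (g * h)
      rw [map_mul, TrivSqZeroExt.snd_mul, TrivSqZeroExt.fst_mul, op_smul_eq_mul, smul_eq_mul,
        Matrix.trace_add] at hgh
      calc ‖((ψ g).snd * (ψ h).fst).trace‖
          ≤ ‖((ψ g).fst * (ψ h).snd).trace + ((ψ g).snd * (ψ h).fst).trace‖
            + ‖((ψ g).fst * (ψ h).snd).trace‖ := norm_le_add_norm_add' _ _
        _ ≤ F ((ψ g).fst * (ψ h).fst) + ‖((ψ g).fst * (ψ h).snd).trace‖ := by gcongr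
        _ ≤ C := hC ⟨_, mem_closedBall_iff_norm.mpr hg, rfl⟩)
  exact ⟨D, fun g hg => hD ⟨g, hg⟩⟩

instance : @CompleteSpace (Matrix n n ℂ)
    (inferInstance : NormedRing (Matrix n n ℂ)).toPseudoMetricSpace.toUniformSpace :=
  FiniteDimensional.complete ℂ (Matrix n n ℂ)

theorem isTangentGraph_tangentSpace {ψ : G →* (Matrix n n ℂ)[ε]}
    (hinv : ∀ g, (ψ g⁻¹).fst.trace = (ψ g).fst.trace ∧ (ψ g⁻¹).snd.trace = (ψ g).snd.trace)
    {r C : ℝ} (hr : 0 < r) (hC : ∀ g, ‖(ψ g).fst - 1‖ ≤ r → ‖(ψ g).snd‖ ≤ C * ‖(ψ g).fst - 1‖) :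
    IsTangentGraph ψ (tangentSpace ψ) where
  trace_fst _ := map_eq_zero_of_mem_tangentSpace
    (T := ⟨Matrix.traceLinearMap n ℝ ℂ ∘ₗ
      (TrivSqZeroExt.fstHom ℝ (Matrix n n ℂ) (Matrix n n ℂ)).toLinearMap,
      continuous_id.matrix_trace.comp TrivSqZeroExt.continuous_fst⟩) fun g => (hinv g).1
  trace_snd _ := map_eq_zero_of_mem_tangentSpace
    (T := ⟨Matrix.traceLinearMap n ℝ ℂ ∘ₗ
      (TrivSqZeroExt.sndHom (Matrix n n ℂ) (Matrix n n ℂ)).restrictScalars ℝ,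
      continuous_id.matrix_trace.comp TrivSqZeroExt.continuous_snd⟩) fun g => (hinv g).2
  eq_zero X hX h0 := TrivSqZeroExt.ext h0 (norm_le_zero_iff.mp (by
    simpa only [h0, norm_zero, mul_zero] using norm_snd_le_of_mem_tangentSpace hr hC hX))
  lie_mem _ hX _ hY := mul_sub_mul_mem_tangentSpace hX hY
  conj_mem _ hX := conj_mem_tangentSpace hX

theorem exists_fst_eq_one_of_norm_trace_le [Nonempty n] {ψ : G →* (Matrix n n ℂ)[ε]}
    (hirr : AdIrreducible fun g => (ψ g).fst)
    (hspan : Submodule.span ℂ (Set.range fun g => (ψ g).fst) = ⊤)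
    {F : Matrix n n ℂ → ℝ} (hF : Continuous F) (hψ : ∀ g, ‖(ψ g).snd.trace‖ ≤ F (ψ g).fst)
    (hinv : ∀ g, (ψ g⁻¹).fst.trace = (ψ g).fst.trace ∧ (ψ g⁻¹).snd.trace = (ψ g).snd.trace)
    {g : G} (hg : (ψ g).fst.trace * (ψ g).snd.trace ≠ 0) :
    ∃ δ > 0, ∀ g, ‖(ψ g).fst - 1‖ < δ → (ψ g).fst = 1 := by
  obtain ⟨D, hD⟩ := exists_norm_snd_le hspan hF hψ
  have hC (g : G) := norm_snd_le_mul_of_bounded hD (g := g)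
  by_contra! hacc
  have : FiniteDimensional ℝ (Matrix n n ℂ) := FiniteDimensional.complexToReal _
  obtain ⟨X, hX, hX0⟩ := exists_mem_tangentSpace_fst_ne_zero (by norm_num) hC
    fun δ hδ => (hacc δ hδ).imp fun _ => And.symm
  have htr := (isTangentGraph_tangentSpace hinv (by norm_num) hC).trace_mul_trace_add_eq_zero
    hirr hX hX0 (g := g) (by rw [← map_mul, mul_inv_cancel, map_one])
  rw [(hinv g).1, (hinv g).2, mul_comm (ψ g).snd.trace, ← two_mul] at htr
  exact mul_ne_zero two_ne_zero hg htr

end Rigidity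

/-! ### Discreteness and freeness of the standard pair -/

section AdIrreducible

variable {K : Type*} [Field K] {N : Submodule K (Matrix (Fin 2) (Fin 2) K)}

theorem eq_of_trace_eq_zero {X : Matrix (Fin 2) (Fin 2) K} (hX : X.trace = 0) :
    X = !![X 0 0, X 0 1; X 1 0, -X 0 0] := by
  rw [Matrix.trace_fin_two] at hX
  rw [neg_eq_of_add_eq_zero_right hX]
  exact Matrix.eta_fin_two X

theorem turnSL_mem_of_apply_ne {X : Matrix (Fin 2) (Fin 2) K} (htr : X.trace = 0) (hX : X ∈ N)
    (hJ : (turnSL K).1 * X * (turnSL K)⁻¹.1 ∈ N) (hne : X 0 1 ≠ X 1 0) : (turnSL K).1 ∈ N := by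
  have hsum : X + (turnSL K).1 * X * (turnSL K)⁻¹.1 = (X 1 0 - X 0 1) • (turnSL K).1 := by
    rw [coe_turnSL_inv, coe_turnSL, eq_of_trace_eq_zero htr]
    ext i j
    fin_cases i <;> fin_cases j <;> simp [← sub_eq_add_neg]
  rw [← N.smul_mem_iff (sub_ne_zero.mpr hne.symm), ← hsum]
  exact N.add_mem hX hJ

theorem symm_mem_of_mem {X : Matrix (Fin 2) (Fin 2) K} (htr : X.trace = 0) (hX : X ∈ N)
    (hJ : (turnSL K).1 * X * (turnSL K)⁻¹.1 ∈ N) :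
    !![2 * X 0 0, X 0 1 + X 1 0; X 0 1 + X 1 0, -(2 * X 0 0)] ∈ N := by
  convert N.sub_mem hX hJ using 1
  rw [coe_turnSL_inv, coe_turnSL, eq_of_trace_eq_zero htr]
  ext i j
  fin_cases i <;> fin_cases j <;> simp <;> ring

variable {u : Kˣ} {c : K}

theorem upperSL_conj_eq (u : Kˣ) (c x y z : K) :
    (upperSL u c).1 * !![x, y; z, -x] * (upperSL u c)⁻¹.1 =
      !![x + c * (u⁻¹ : Kˣ) * z, u ^ 2 * y - 2 * c * u * x - c ^ 2 * z;
        (u⁻¹ : Kˣ) ^ 2 * z, -(x + c * (u⁻¹ : Kˣ) * z)] := by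
  have hu := u.mul_inv
  rw [upperSL_inv, coe_upperSL, coe_upperSL, inv_inv, Matrix.mul_fin_two, Matrix.mul_fin_two]
  ext i j
  fin_cases i <;> fin_cases j <;>
    simp only [Fin.zero_eta, Fin.mk_one, Matrix.of_apply, Matrix.cons_val', Matrix.cons_val_zero,
      Matrix.cons_val_one, Matrix.cons_val_fin_one]
  · linear_combination x * hu
  · ring
  · ring
  · linear_combination -x * hu

theorem upperSL_inv_conj_eq (u : Kˣ) (c x y z : K) :
    (upperSL u c)⁻¹.1 * !![x, y; z, -x] * (upperSL u c).1 =
      !![x - c * u * z, (u⁻¹ : Kˣ) ^ 2 * y + 2 * c * (u⁻¹ : Kˣ) * x - c ^ 2 * z;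
        u ^ 2 * z, -(x - c * u * z)] := by
  have h := upperSL_conj_eq u⁻¹ (-c) x y z
  rw [← upperSL_inv, inv_inv, inv_inv] at h
  rw [h]
  ext i j
  fin_cases i <;> fin_cases j <;>
    simp only [Fin.zero_eta, Fin.mk_one, Matrix.of_apply, Matrix.cons_val', Matrix.cons_val_zero,
      Matrix.cons_val_one, Matrix.cons_val_fin_one] <;>
    ring

theorem det_symm_ne_zero (h2c : 2 * c ≠ 0) (ht : (u : K) + (u⁻¹ : Kˣ) ≠ 0)
    (hγ : ((u : K) - (u⁻¹ : Kˣ)) ^ 2 + c ^ 2 ≠ 0) :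
    2 * c * ((u⁻¹ : Kˣ) * (u ^ 2 - (u⁻¹ : Kˣ) ^ 2 - c ^ 2) +
      u * ((u⁻¹ : Kˣ) ^ 2 - u ^ 2 - c ^ 2)) ≠ 0 := by
  convert neg_ne_zero.mpr (mul_ne_zero h2c (mul_ne_zero ht hγ)) using 1
  ring

theorem eq_zero_of_conj_symm (h2c : 2 * c ≠ 0) (ht : (u : K) + (u⁻¹ : Kˣ) ≠ 0)
    (hγ : ((u : K) - (u⁻¹ : Kˣ)) ^ 2 + c ^ 2 ≠ 0) {X : Matrix (Fin 2) (Fin 2) K}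
    (htr : X.trace = 0) (hX : X 0 1 = X 1 0)
    (hA : ((upperSL u c).1 * X * (upperSL u c)⁻¹.1) 0 1 =
      ((upperSL u c).1 * X * (upperSL u c)⁻¹.1) 1 0)
    (hA' : ((upperSL u c)⁻¹.1 * X * (upperSL u c).1) 0 1 =
      ((upperSL u c)⁻¹.1 * X * (upperSL u c).1) 1 0) : X = 0 := by
  rw [eq_of_trace_eq_zero htr, ← hX] at hA hA' ⊢
  rw [upperSL_conj_eq] at hA
  rw [upperSL_inv_conj_eq] at hA'
  simp only [Matrix.of_apply, Matrix.cons_val', Matrix.cons_val_zero, Matrix.cons_val_one,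
    Matrix.cons_val_fin_one] at hA hA'
  have hd := det_symm_ne_zero h2c ht hγ
  have h00 : X 0 0 = 0 := by
    refine (mul_eq_zero_iff_left hd).mp ?_
    linear_combination (u ^ 2 - (u⁻¹ : Kˣ) ^ 2 - c ^ 2) * hA' -
      ((u⁻¹ : Kˣ) ^ 2 - u ^ 2 - c ^ 2) * hA
  have h01 : X 0 1 = 0 := by
    refine (mul_eq_zero_iff_left hd).mp ?_
    linear_combination 2 * c * u * hA' + 2 * c * (u⁻¹ : Kˣ) * hA
  rw [h00, h01, neg_zero]
  exact (Matrix.eta_fin_two 0).symm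

theorem symm_mem_of_turnSL_mem (h2c : 2 * c ≠ 0) (ht : (u : K) + (u⁻¹ : Kˣ) ≠ 0)
    (hγ : ((u : K) - (u⁻¹ : Kˣ)) ^ 2 + c ^ 2 ≠ 0)
    (hA : ∀ X ∈ N, (upperSL u c).1 * X * (upperSL u c)⁻¹.1 ∈ N)
    (hA' : ∀ X ∈ N, (upperSL u c)⁻¹.1 * X * (upperSL u c).1 ∈ N)
    (hJ : ∀ X ∈ N, (turnSL K).1 * X * (turnSL K)⁻¹.1 ∈ N) (hJN : (turnSL K).1 ∈ N) (x y : K) :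
    !![x, y; y, -x] ∈ N := by
  have hturn : (turnSL K).1 = !![0, -1; 1, -0] := by rw [coe_turnSL, neg_zero]
  have h1 := hA _ hJN
  have h2 := hA' _ hJN
  rw [hturn, upperSL_conj_eq] at h1
  rw [hturn, upperSL_inv_conj_eq] at h2
  have h3 := symm_mem_of_mem (by simp [Matrix.trace_fin_two]) h1 (hJ _ h1)
  have h4 := symm_mem_of_mem (by simp [Matrix.trace_fin_two]) h2 (hJ _ h2)
  simp only [Matrix.of_apply, Matrix.cons_val', Matrix.cons_val_zero, Matrix.cons_val_one,
    Matrix.cons_val_fin_one] at h3 h4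
  rw [← N.smul_mem_iff (det_symm_ne_zero h2c ht hγ)]
  convert N.add_mem (N.smul_mem (x * (u ^ 2 - (u⁻¹ : Kˣ) ^ 2 - c ^ 2) + y * (2 * c * u)) h3)
    (N.smul_mem (y * (2 * c * (u⁻¹ : Kˣ)) - x * ((u⁻¹ : Kˣ) ^ 2 - u ^ 2 - c ^ 2)) h4) using 1
  rw [Matrix.smul_of, Matrix.smul_of, Matrix.smul_of, Matrix.of_add_of]
  congr 1
  ext i j
  fin_cases i <;> fin_cases j <;>
    simp only [Fin.zero_eta, Fin.mk_one, Pi.smul_apply, Pi.add_apply, Matrix.cons_val_zero,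
      Matrix.cons_val_one, Matrix.cons_val_fin_one, smul_eq_mul] <;>
    ring

theorem adIrreducible_of_eq_upperSL_of_eq_turnSL {G : Type*} [Group G] {ρ : G →* SL(2, K)}
    {a b : G} (ha : ρ a = upperSL u c) (hb : ρ b = turnSL K) (h2c : 2 * c ≠ 0)
    (ht : (u : K) + (u⁻¹ : Kˣ) ≠ 0) (hγ : ((u : K) - (u⁻¹ : Kˣ)) ^ 2 + c ^ 2 ≠ 0) :
    AdIrreducible fun g => (ρ g).1 := by
  intro N htr hN X hX hX0
  have hA (Y) (hY : Y ∈ N) : (upperSL u c).1 * Y * (upperSL u c)⁻¹.1 ∈ N := by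
    simpa only [map_inv, ha] using hN a Y hY
  have hA' (Y) (hY : Y ∈ N) : (upperSL u c)⁻¹.1 * Y * (upperSL u c).1 ∈ N := by
    simpa only [map_inv, inv_inv, ha] using hN a⁻¹ Y hY
  have hJ (Y) (hY : Y ∈ N) : (turnSL K).1 * Y * (turnSL K)⁻¹.1 ∈ N := by
    simpa only [map_inv, hb] using hN b Y hY
  have hJN : (turnSL K).1 ∈ N := by
    by_contra hJN
    have hsymm (Y) (hY : Y ∈ N) : Y 0 1 = Y 1 0 :=
      not_imp_comm.mp (turnSL_mem_of_apply_ne (htr Y hY) hY (hJ Y hY)) hJN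
    exact hX0 (eq_zero_of_conj_symm h2c ht hγ (htr X hX) (hsymm X hX) (hsymm _ (hA X hX))
      (hsymm _ (hA' X hX)))
  intro Y hY
  rw [eq_of_trace_eq_zero hY]
  convert N.add_mem (symm_mem_of_turnSL_mem h2c ht hγ hA hA' hJ hJN (Y 0 0)
    ((Y 0 1 + Y 1 0) / 2)) (N.smul_mem ((Y 1 0 - Y 0 1) / 2) hJN) using 1
  have h2 : (2 : K) ≠ 0 := left_ne_zero_of_mul h2c
  ext i j
  fin_cases i <;> fin_cases j <;> simp [coe_turnSL] <;> field

theorem span_range_eq_top_of_eq_upperSL_of_eq_turnSL {G : Type*} [Group G] {ρ : G →* SL(2, K)}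
    {a b : G} (ha : ρ a = upperSL u c) (hb : ρ b = turnSL K) (h2c : 2 * c ≠ 0)
    (ht : (u : K) + (u⁻¹ : Kˣ) ≠ 0) (hγ : ((u : K) - (u⁻¹ : Kˣ)) ^ 2 + c ^ 2 ≠ 0) :
    Submodule.span K (Set.range fun g => (ρ g).1) = ⊤ := by
  have : NeZero (Fintype.card (Fin 2) : K) := ⟨by simpa using left_ne_zero_of_mul h2c⟩
  refine AdIrreducible.span_eq_top (ρ := Matrix.SpecialLinearGroup.coeMonoidHom.comp ρ)
    (adIrreducible_of_eq_upperSL_of_eq_turnSL ha hb h2c ht hγ) (g := b) fun k hk => ?_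
  simpa [hb, coe_turnSL] using congrFun (congrFun hk 1) 0

end AdIrreducible

section Jet

/-- The value of a matrix of polynomials at the dual number `c + ε`. -/
noncomputable def jet (c : ℂ) : SL(2, ℂ[X]) →* (Matrix (Fin 2) (Fin 2) ℂ)[ε] where
  toFun g := Matrix.dualNumberEquiv (g.1.map (aeval (TrivSqZeroExt.inl c + ε)))
  map_one' := by
    rw [Matrix.SpecialLinearGroup.coe_one, Matrix.map_one _ (map_zero _) (map_one _), map_one]
  map_mul' g h := by rw [Matrix.SpecialLinearGroup.coe_mul, Matrix.map_mul, map_mul]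

theorem jet_apply (c : ℂ) (g : SL(2, ℂ[X])) :
    jet c g = Matrix.dualNumberEquiv (g.1.map (aeval (TrivSqZeroExt.inl c + ε))) := rfl

theorem aeval_inl_add_eps (c : ℂ) (p : ℂ[X]) :
    aeval (TrivSqZeroExt.inl c + ε : ℂ[ε]) p =
      TrivSqZeroExt.inl (p.eval c) + TrivSqZeroExt.inr ((derivative p).eval c) := by
  have h (q : ℂ[X]) : aeval (TrivSqZeroExt.inl c : ℂ[ε]) q = TrivSqZeroExt.inl (q.eval c) :=
    (aeval_algebraMap_apply_eq_algebraMap_eval c q)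
  rw [aeval_add_of_sq_eq_zero _ _ _ (by rw [sq, DualNumber.eps_mul_eps]), h, h]
  ext <;> simp

theorem fst_jet (c : ℂ) (g : SL(2, ℂ[X])) :
    (jet c g).fst = (Matrix.SpecialLinearGroup.map (evalRingHom c) g).1 := by
  ext i j
  simp [jet_apply, aeval_inl_add_eps]

theorem trace_fst_jet (c : ℂ) (g : SL(2, ℂ[X])) : (jet c g).fst.trace = g.1.trace.eval c := by
  rw [fst_jet]
  exact (AddMonoidHom.map_trace (evalRingHom c) g.1).symm

theorem trace_snd_jet (c : ℂ) (g : SL(2, ℂ[X])) :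
    (jet c g).snd.trace = (derivative g.1.trace).eval c := by
  simp [jet_apply, aeval_inl_add_eps, Matrix.trace_fin_two]

end Jet

section Isolated

attribute [local instance] Matrix.linftyOpNormedRing Matrix.linftyOpNormedAlgebra

theorem exists_eq_one_of_norm_eval_derivative_trace_le {u : ℂˣ} {c : ℂ} {C : ℝ} (hc : c ≠ 0)
    (ht : (u : ℂ) + (u⁻¹ : ℂˣ) ≠ 0) (hγ : ((u : ℂ) - (u⁻¹ : ℂˣ)) ^ 2 + c ^ 2 ≠ 0)
    (hC : ∀ g ∈ Subgroup.closure {polyUpper u, turnSL ℂ[X]},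
      ‖(derivative g.1.trace).eval c‖ ≤ C * ‖g.1.trace.eval c ^ 2 - 4‖) :
    ∃ δ > 0, ∀ g ∈ Subgroup.closure {upperSL u c, turnSL ℂ}, ‖g.1 - 1‖ < δ → g = 1 := by
  set Γ := Subgroup.closure {polyUpper u, turnSL ℂ[X]}
  let ψ : Γ →* (Matrix (Fin 2) (Fin 2) ℂ)[ε] := (jet c).comp Γ.subtype
  let ev : SL(2, ℂ[X]) →* SL(2, ℂ) := Matrix.SpecialLinearGroup.map (evalRingHom c)
  let ρ : Γ →* SL(2, ℂ) := ev.comp Γ.subtype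
  have hψρ : (fun g => (ψ g).fst) = fun g => (ρ g).1 := funext fun g => fst_jet c g
  have hfst (g : Γ) : (ψ g).fst.trace = g.1.1.trace.eval c := trace_fst_jet c g
  have hsnd (g : Γ) : (ψ g).snd.trace = (derivative g.1.1.trace).eval c := trace_snd_jet c g
  let a : Γ := ⟨polyUpper u, Subgroup.subset_closure (Set.mem_insert _ _)⟩
  let b : Γ := ⟨turnSL ℂ[X], Subgroup.subset_closure (Set.mem_insert_of_mem _ rfl)⟩
  have ha : ρ a = upperSL u c := map_eval_polyUpper u c
  have hb : ρ b = turnSL ℂ := map_turnSL _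
  have h2c : 2 * c ≠ 0 := mul_ne_zero two_ne_zero hc
  have hab : (a * b).1.1.trace = X := by
    simp [a, b, Matrix.trace_fin_two, polyUpper, coe_upperSL, coe_turnSL]
  obtain ⟨δ, hδ, h⟩ := exists_fst_eq_one_of_norm_trace_le (ψ := ψ)
    (F := fun x => C * ‖x.trace ^ 2 - 4‖) (g := a * b)
    (hψρ ▸ adIrreducible_of_eq_upperSL_of_eq_turnSL ha hb h2c ht hγ)
    (hψρ ▸ span_range_eq_top_of_eq_upperSL_of_eq_turnSL ha hb h2c ht hγ) (by fun_prop)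
    (fun g => by rw [hfst, hsnd]; exact hC g g.2)
    (fun g => by rw [hfst, hfst, hsnd, hsnd, Subgroup.coe_inv, trace_inv_SL2]; exact ⟨rfl, rfl⟩)
    (by rw [hfst, hsnd, hab, derivative_X, eval_X, eval_one, mul_one]; exact hc)
  have hmap : Γ.map ev = Subgroup.closure {upperSL u c, turnSL ℂ} := by
    rw [MonoidHom.map_closure, Set.image_pair]
    rw [show ev (polyUpper u) = upperSL u c from ha, show ev (turnSL ℂ[X]) = turnSL ℂ from hb]
  refine ⟨δ, hδ, hmap ▸ ?_⟩
  rintro _ ⟨g, hg, rfl⟩ hg1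
  have hg' : (ψ ⟨g, hg⟩).fst = (ev g).1 := congrFun hψρ ⟨g, hg⟩
  exact Subtype.ext (hg'.symm.trans (h ⟨g, hg⟩ (by rwa [hg'])))

end Isolated

section DiscreteSubgroup

variable {G : Type*} [Group G] [TopologicalSpace G] [IsTopologicalGroup G]

theorem discreteTopology_iff_eventually_eq_one {H : Subgroup G} :
    DiscreteTopology H ↔ ∀ᶠ g in 𝓝 (1 : G), g ∈ H → g = 1 := by
  rw [discreteTopology_iff_isOpen_singleton_one, isOpen_singleton_iff_nhds_eq_pure,
    (pure_le_nhds (1 : H)).ge_iff_eq'.symm, le_pure_iff, nhds_subtype, ← eventually_mem_set,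
    eventually_comap]
  exact eventually_congr <| .of_forall fun g =>
    ⟨fun h hg => congrArg Subtype.val (h ⟨g, hg⟩ rfl), fun h x hx => Subtype.ext <|
      hx.trans (h (hx ▸ x.2))⟩

theorem discreteTopology_map_conj {H : Subgroup G} [hH : DiscreteTopology H] (k : G) :
    DiscreteTopology (H.map (MulAut.conj k).toMonoidHom) := by
  rw [discreteTopology_iff_eventually_eq_one] at hH ⊢
  have hk : Tendsto (fun g => k⁻¹ * g * k) (𝓝 1) (𝓝 1) := by
    have : ContinuousAt (fun g => k⁻¹ * g * k) 1 := by fun_prop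
    simpa [ContinuousAt] using this
  filter_upwards [hk.eventually hH]
  rintro _ hg ⟨h, hh, rfl⟩
  have hconj : k⁻¹ * (k * h * k⁻¹) * k = h := by group
  obtain rfl : h = 1 := hconj ▸ hg (hconj.symm ▸ hh)
  exact map_one _

theorem discreteTopology_map_mk {N H : Subgroup G} [N.Normal] (hN : N ≤ H)
    [hH : DiscreteTopology H] : DiscreteTopology (H.map (QuotientGroup.mk' N)) := by
  rw [discreteTopology_iff_eventually_eq_one] at hH ⊢
  rw [← QuotientGroup.mk_one, QuotientGroup.nhds_eq, eventually_map]
  filter_upwards [hH] with g hg hgN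
  rw [← QuotientGroup.mk'_apply, ← Subgroup.mem_comap, QuotientGroup.comap_map_mk',
    sup_eq_right.mpr hN] at hgN
  rw [hg hgN]

end DiscreteSubgroup

section Discrete

attribute [local instance] Matrix.linftyOpNormedRing Matrix.linftyOpNormedAlgebra

theorem discreteTopology_of_norm_sub_one_lt {N : Subgroup SL(2, ℂ)} {δ : ℝ} (hδ : 0 < δ)
    (hN : ∀ g ∈ N, ‖g.1 - 1‖ < δ → g = 1) : DiscreteTopology N := by
  rw [discreteTopology_iff_eventually_eq_one]
  have hcont : Continuous fun g : SL(2, ℂ) => g.1 := continuous_subtype_val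
  filter_upwards [hcont.continuousAt.eventually (Metric.ball_mem_nhds _ hδ)] with g hg hgN
  exact hN g hgN (mem_ball_iff_norm.mp hg)

theorem generatesDiscrete_mk_conj {A B : SL(2, ℂ)} (T : SL(2, ℂ)) (hB : B.1.trace = 0)
    (h : DiscreteTopology (Subgroup.closure {A, B})) :
    GeneratesDiscrete (QuotientGroup.mk (T * A * T⁻¹)) (QuotientGroup.mk (T * B * T⁻¹)) := by
  have hconj : DiscreteTopology (Subgroup.closure {T * A * T⁻¹, T * B * T⁻¹}) := by
    have := discreteTopology_map_conj (H := Subgroup.closure {A, B}) T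
    rwa [MonoidHom.map_closure, Set.image_pair] at this
  have hcen : Subgroup.center SL(2, ℂ) ≤ Subgroup.closure {T * A * T⁻¹, T * B * T⁻¹} :=
    center_le_of_mem_of_trace_eq_zero (B := T * B * T⁻¹)
      (Subgroup.subset_closure (Set.mem_insert_of_mem _ rfl)) ((trace_conj_SL2 B T).trans hB)
  have hmap := discreteTopology_map_mk hcen
  rwa [MonoidHom.map_closure, Set.image_pair] at hmap

theorem generatesDiscrete_of_forall_ne_zero {u : ℂˣ} {c : ℂ} (T : SL(2, ℂ)) (hc : c ≠ 0)
    (ht : (u : ℂ) + (u⁻¹ : ℂˣ) ≠ 0) (hγ : ((u : ℂ) - (u⁻¹ : ℂˣ)) ^ 2 + c ^ 2 ≠ 0)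
    (h0 : ∀ᶠ z in 𝓝 c, ∀ rs, IsReduced u rs →
      commTrace (upperSL u z) (altProd (upperSL u z) (turnSL ℂ) 1 rs) ≠ 0) :
    GeneratesDiscrete (QuotientGroup.mk (T * upperSL u c * T⁻¹))
      (QuotientGroup.mk (T * turnSL ℂ * T⁻¹)) := by
  obtain ⟨ρ, hρ, hball⟩ := Metric.eventually_nhds_iff_ball.mp h0
  obtain ⟨δ, hδ, h⟩ := exists_eq_one_of_norm_eval_derivative_trace_le hc ht hγ
    fun g hg => norm_eval_derivative_trace_le hρ (fun rs hrs z hz => hball z hz rs hrs) hg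
  exact generatesDiscrete_mk_conj T trace_turnSL (discreteTopology_of_norm_sub_one_lt hδ h)

end Discrete

section Existence

theorem exists_commTrace_eq_zero_of_not_isFreeOn {A B : SL(2, ℂ)} (hB : B.1.trace = 0)
    (h : ¬ IsFreeOn (QuotientGroup.mk A) (QuotientGroup.mk B)) :
    ∃ rs : List ℤ, (∀ r ∈ rs, A ^ r ∉ Subgroup.center SL(2, ℂ)) ∧
      commTrace A (altProd A B 1 rs) = 0 := by
  have hinv : (QuotientGroup.mk B : Moebius) * QuotientGroup.mk B = 1 :=
    (QuotientGroup.eq_one_iff _).mpr (mul_self_mem_center_of_trace_eq_zero hB)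
  obtain ⟨r, r', rs, hrs, hrel⟩ := exists_relation_of_not_injective_lift hinv h
  refine ⟨rs, fun i hi hcen => hrs i hi ((QuotientGroup.eq_one_iff _).mpr hcen), ?_⟩
  refine commTrace_eq_zero_of_mem_center (r := r) (r' := r') ((QuotientGroup.eq_one_iff _).mp ?_)
  rw [← hrel, ← mk_altProd]
  rfl

theorem exists_isReduced_of_not_discrete_and_free {u : ℂˣ} (ht : (u : ℂ) + (u⁻¹ : ℂˣ) ≠ 0)
    {A B : SL(2, ℂ)} (hA : A.1.trace = u + (u⁻¹ : ℂˣ)) (hB : B.1.trace = 0)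
    (hAB : ¬ (GeneratesDiscrete (QuotientGroup.mk A) (QuotientGroup.mk B) ∧
      IsFreeOn (QuotientGroup.mk A) (QuotientGroup.mk B)))
    {U : Set ℂ} (hU : IsOpen U) (hγ : commTrace A B ∈ U) :
    ∃ rs z, IsReduced u rs ∧ ((u : ℂ) - (u⁻¹ : ℂˣ)) ^ 2 + z ^ 2 ∈ U ∧
      commTrace (upperSL u z) (altProd (upperSL u z) (turnSL ℂ) 1 rs) = 0 := by
  by_cases hγ0 : commTrace A B = 0
  · obtain ⟨z, hz⟩ := IsAlgClosed.exists_pow_nat_eq (-((u : ℂ) - (u⁻¹ : ℂˣ)) ^ 2) two_pos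
    refine ⟨[], z, isReduced_nil u, ?_, ?_⟩
    · rwa [hz, add_neg_cancel, ← hγ0]
    · rw [altProd, zpow_one, commTrace_upperSL_turnSL, hz, add_neg_cancel]
  obtain ⟨c, T, rfl, rfl⟩ := exists_conj_upperSL_turnSL hA hB hγ0
  rw [commTrace_conj, commTrace_upperSL_turnSL] at hγ hγ0
  by_cases hc : c = 0
  · subst hc
    exact ⟨[1], 0, isReduced_singleton_one u, hγ, commTrace_upperSL_zero_conj u⟩
  by_contra! hne
  have hnhds : ∀ᶠ z in 𝓝 c, ((u : ℂ) - (u⁻¹ : ℂˣ)) ^ 2 + z ^ 2 ∈ U :=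
    (hU.preimage (f := fun z : ℂ => ((u : ℂ) - (u⁻¹ : ℂˣ)) ^ 2 + z ^ 2) (by fun_prop)).mem_nhds hγ
  refine hAB ⟨generatesDiscrete_of_forall_ne_zero T hc ht hγ0
    (hnhds.mono fun z hz rs hrs => hne rs z hrs hz), ?_⟩
  by_contra hfree
  obtain ⟨rs, hrs, h0⟩ := exists_commTrace_eq_zero_of_not_isFreeOn hB hfree
  rw [altProd_conj, commTrace_conj] at h0
  refine hne rs c (fun r hr hcen => hrs r hr ?_) hγ h0
  rw [conj_zpow]
  exact Subgroup.Normal.conj_mem inferInstance _ (upperSL_zpow_mem_center c hcen) T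

end Existence

end TraceRoots

theorem theorem12p1 (f g : TraceRoots.Moebius)
    (hf : TraceRoots.beta f ≠ -4) (hg : TraceRoots.beta g = -4)
    (hfg : ¬ (TraceRoots.GeneratesDiscrete f g ∧ TraceRoots.IsFreeOn f g))
    (U : Set ℂ) (hU : IsOpen U) (hγ : TraceRoots.gamma f g ∈ U) :
    ∃ w : FreeGroup (Fin 2), TraceRoots.IsGoodWord w ∧
      ∃ p : Polynomial (Polynomial ℤ), TraceRoots.IsTracePolynomial w p ∧
        TraceRoots.specialize p (TraceRoots.beta f) ≠ 0 ∧
        ∃ z ∈ U, (TraceRoots.specialize p (TraceRoots.beta f)).IsRoot z := by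
  obtain ⟨A, rfl⟩ := QuotientGroup.mk_surjective f
  obtain ⟨B, rfl⟩ := QuotientGroup.mk_surjective g
  obtain ⟨u, hu⟩ := TraceRoots.exists_add_inv_eq A.1.trace
  have hβ : TraceRoots.beta (QuotientGroup.mk A) = ((u : ℂ) - (u⁻¹ : ℂˣ)) ^ 2 := by
    rw [TraceRoots.beta_mk, ← hu]
    linear_combination 4 * u.mul_inv
  have ht : (u : ℂ) + (u⁻¹ : ℂˣ) ≠ 0 := fun h => hf <| by
    rw [TraceRoots.beta_mk, ← hu, h]
    norm_num
  have hB : B.1.trace = 0 := by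
    rw [TraceRoots.beta_mk] at hg
    exact pow_eq_zero_iff two_ne_zero |>.mp (by linear_combination hg)
  obtain ⟨rs, z, hrs, hz, h0⟩ :=
    TraceRoots.exists_isReduced_of_not_discrete_and_free ht hu.symm hB hfg hU hγ
  obtain ⟨w, hw, p, hp, hp0, hroot⟩ := TraceRoots.exists_isRoot_specialize hrs h0
  rw [hβ]
  exact ⟨w, hw, p, hp, hp0, _, hz, hroot⟩
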